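/- **Setting.** For each $n$ we observe an i.i.d. sample $(X_1,W_1),\dots,(X_n,W_n)$ from $P\in\mathcal P$, where $\mathcal P$ is a class of probability distributions on $\mathbb R^{d_X}\times\mathbb R^{d_W}$ that are all concentrated on a Borel set $D$ (the sample space). Let $\Theta\subseteq\mathbb R^d$ be a Borel (or, more generally, analytic) set, let $m:\mathbb R^{d_W}\times\Theta\to\mathbb R^{d_Y}$ be measurable with $E_P|m_j(W_i,\theta)|<\infty$ for all $j$, $\theta\in\Theta$, $P\in\mathcal P$, and let $$\Theta_0(P)=\{\theta\in\Theta: E_P[m(W_i,\theta)\mid X_i]\ge 0\ \ P\text{-a.s.}\}.$$ Let $\mathcal G$ be a class of functions $g:\mathbb R^{d_X}\to\mathbb R^{d_Y}$ of the form $\{g_t:t\in T\}$ with $T$ a standard Borel space and $(t,x)\mapsto g_t(x)$ jointly measurable. Put $\mu_{P,j}(\theta,g)=E_P m_j(W_i,\theta)g_j(X_i)$, $\sigma_{P,j}(\theta,g)=\{E_P[m_j(W_i,\theta)g_j(X_i)]^2-\mu_{P,j}(\theta,g)^2\}^{1/2}$, and let $\hat\mu_{n,j},\hat\sigma_{n,j}$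 be their sample analogues (with $E_P$ replaced by the sample mean). For $S:\mathbb R^{d_Y}\to[0,\infty)$, truncation points $\sigma_n$ and critical values $\hat c_n$ (both real valued and possibly data dependent) let $$T_n(\theta)=\sup_{g\in\mathcal G}S\left(\frac{\hat\mu_{n,1}(\theta,g)}{\hat\sigma_{n,1}(\theta,g)\vee\sigma_n},\dots,\frac{\hat\mu_{n,d_Y}(\theta,g)}{\hat\sigma_{n,d_Y}(\theta,g)\vee\sigma_n}\right),\qquad \mathcal C_n(\hat c_n)=\left\{\theta\in\Theta:\tfrac{\sqrt n}{\sqrt{\log n}}T_n(\theta)\le\hat c_n\right\}.$$ Let $d(\theta,A)=\inf_{a\in A}\|\theta-a\|$ ($=\infty$ if $A=\emptyset$), and let $d_H(A,B)\in[0,\infty]$ be the Hausdorff distance for the Euclidean norm, with $d_H(\emptyset,\emptyset)=0$ and $d_H(A,\emptyset)=\infty$ for $A\neq\emptyset$. "With probability approaching one uniformly" (w.p.a.1 uniformly) means that the supremum over $P\in\mathcal P$ of the probability of the complementary event tends to $0$ as $n\to\infty$; probabilities of possibly non-measurable events are outer probabilities. **Assumptions.** 1. $g_j(X_i)\ge0$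 $P$-a.s. for all $j$, $g\in\mathcal G$, $P\in\mathcal P$. 2. There are $A,V>0$ such that, for each $j$, the classes $\mathcal F_{j,1}=\{s\,m_j(w,\theta)g_j(x)+t:\theta\in\Theta,g\in\mathcal G,s,t\in[-(\overline Y\vee1),\overline Y\vee1]\}$ and $\mathcal F_{j,2}=\{f^2:f\in\mathcal F_{j,1}\}$ satisfy $\sup_Q N(\varepsilon,\mathcal F_{j,i},L_1(Q))\le A\varepsilon^{-V}$ for $0<\varepsilon<1$, where $Q$ ranges over all probability measures on $D$ and $N$ is the $L_1(Q)$ covering number (centers are integrable functions, not necessarily in the class). 3. For a constant $\overline Y\ge0$: $|m_j(W_i,\theta)g_j(X_i)|\le\overline Y$ $P$-a.s. for all $j$, $\theta\in\Theta$, $g\in\mathcal G$, $P\in\mathcal P$. 4. $S(t)>0$ iff $t_j<0$ for some $j$; and for positive constants $K_{S,1},K_{S,2}$ and all $c>0$: $S(t)\ge c$ implies $t_j\le-cK_{S,1}$ for some $j$, and $S(t)\le c$ implies $t_j\ge-cK_{S,2}$ for all $j$. 5. For some constant $M$, $\sigma_n\le M$ w.p.a.1 uniformly, and, for some possibly data dependent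 $\hat a_n$, $\sigma_n\sqrt{n/\log n}\ge\hat a_n$ w.p.a.1 uniformly. 6. $\hat a_n\ge K$ and $\hat c_n\ge K$ w.p.a.1 uniformly, and $\sup_{P\in\mathcal P}P(\hat c_n\sqrt{(\log n)/n}>\eta)\to0$ for every $\eta>0$. 7. For every $\varepsilon>0$ there is $\delta'>0$ such that for all $P\in\mathcal P$ and $\theta\in\Theta$ with $d(\theta,\Theta_0(P))>\varepsilon$ there are $g\in\mathcal G$ and $j$ with $\mu_{P,j}(\theta,g)<-\delta'$. 8. (Polynomial minorant.) For some constants $C,\psi,\gamma,\delta>0$ with $\psi\le1$: (i) for all $P\in\mathcal P$ and $\theta\in\Theta$ with $0<d(\theta,\Theta_0(P))\le\delta$, $$\inf_{g\in\mathcal G,\,1\le j\le d_Y}\frac{\mu_{P,j}(\theta,g)}{\sigma_{P,j}(\theta,g)\vee d(\theta,\Theta_0(P))^{\psi/\gamma}}\le -C\,d(\theta,\Theta_0(P))^{1/\gamma};$$ (ii) for some constant $M'$, $\sigma_n(n/\log n)^{\psi/2}\le M'$ w.p.a.1 uniformly. **Theorem.** For all $V,K_{S,1}>0$ and $\overline Y\ge0$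 there is a constant $K_0$, depending only on $V$, $\overline Y$ and $K_{S,1}$, such that if Assumptions 1–8 hold with these constants and with some $K>K_0$, then there is $B>0$, not depending on $P$ or $n$, such that $$\sup_{P\in\mathcal P}P\left(\left(\frac{n}{\hat c_n^2\log n}\right)^{\gamma/2}d_H(\mathcal C_n(\hat c_n),\Theta_0(P))>B\right)\longrightarrow0\qquad(n\to\infty).$$ -/

import Mathlib

open MeasureTheory ProbabilityTheory Filter Topology
open scoped ENNReal NNReal

noncomputable section

namespace KSRegion

/-- Euclidean space `ℝ^k`. -/
abbrev Vec (k : ℕ) : Type := EuclideanSpace ℝ (Fin k)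

/-- One observation `(X, W)`. -/
abbrev Obs (dX dW : ℕ) : Type := Vec dX × Vec dW

/-! ### Population and sample means and standard deviations -/

section Moments

variable {Z : Type*} [MeasurableSpace Z]

/-- `E_P f`. -/
def popMean (P : Measure Z) (f : Z → ℝ) : ℝ := ∫ z, f z ∂P

/-- `{E_P f² - (E_P f)²}^{1/2}`. -/
def popSd (P : Measure Z) (f : Z → ℝ) : ℝ :=
  √((∫ z, f z ^ 2 ∂P) - (∫ z, f z ∂P) ^ 2)

/-- `E_n f`, the mean of `f` over the sample `z`. -/
def sampleMean {Z : Type*} {n : ℕ} (z : Fin n → Z) (f : Z → ℝ) : ℝ :=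
  (∑ i, f (z i)) / n

/-- `{E_n f² - (E_n f)²}^{1/2}`. -/
def sampleSd {Z : Type*} {n : ℕ} (z : Fin n → Z) (f : Z → ℝ) : ℝ :=
  √(sampleMean z (fun x => f x ^ 2) - sampleMean z f ^ 2)

/-- The `L₁(Q)` covering number: the least number of integrable functions (not necessarily in `F`)
such that every element of `F` is within `L₁(Q)` distance `ε` of one of them (`⊤` if there is no
finite cover). -/
def coveringNumberL1 (ε : ℝ) (F : Set (Z → ℝ)) (Q : Measure Z) : ℕ∞ :=
  ⨅ (C : Finset (Z → ℝ)) (_ : ∀ c ∈ C, Integrable c Q)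
    (_ : ∀ f ∈ F, ∃ c ∈ C, ∫⁻ z, ‖f z - c z‖ₑ ∂Q ≤ ENNReal.ofReal ε), (C.card : ℕ∞)

/-- The property `E n` of an i.i.d. sample of size `n` holds with probability approaching one
uniformly over `P ∈ 𝔓`: the supremum over `P` of the (outer) probability of its failure tends to
zero. -/
def UniformWPA1 (𝔓 : Set (ProbabilityMeasure Z)) (E : (n : ℕ) → (Fin n → Z) → Prop) : Prop :=
  Tendsto (fun n : ℕ => ⨆ P ∈ 𝔓,
    (Measure.pi fun _ : Fin n => (P : Measure Z)) {z | ¬ E n z}) atTop (𝓝 0)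

end Moments

/-! ### The model and the confidence region -/

section Model

variable {dX dW d dY : ℕ}

/-- The function `(x, w) ↦ m_j(w, θ) g_j(x)`. -/
def moment (m : Vec dW → Vec d → Fin dY → ℝ) (θ : Vec d) (g : Vec dX → Fin dY → ℝ) (j : Fin dY) :
    Obs dX dW → ℝ :=
  fun z => m z.2 θ j * g z.1 j

/-- The identified set `Θ₀(P) = {θ ∈ Θ : E_P[m(W, θ) | X] ≥ 0 a.s.}`. -/
def identifiedSet (Θ : Set (Vec d)) (m : Vec dW → Vec d → Fin dY → ℝ)
    (P : Measure (Obs dX dW)) : Set (Vec d) :=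
  {θ | θ ∈ Θ ∧ ∀ j, 0 ≤ᵐ[P]
    P[(fun z : Obs dX dW => m z.2 θ j) |
      MeasurableSpace.comap (Prod.fst : Obs dX dW → Vec dX) inferInstance]}

/-- The Kolmogorov-Smirnov statistic `T_n(θ)` for the sample `z` and the truncation point `σ`. -/
def ksStat (m : Vec dW → Vec d → Fin dY → ℝ) (𝒢 : Set (Vec dX → Fin dY → ℝ))
    (S : (Fin dY → ℝ) → ℝ≥0) {n : ℕ} (z : Fin n → Obs dX dW) (σ : ℝ) (θ : Vec d) : ℝ≥0∞ :=
  ⨆ g ∈ 𝒢, (S fun j =>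
    sampleMean z (moment m θ g j) / max (sampleSd z (moment m θ g j)) σ : ℝ≥0∞)

/-- The confidence region `C_n(c) = {θ ∈ Θ : (√n / √(log n)) T_n(θ) ≤ c}`. -/
def region (Θ : Set (Vec d)) (m : Vec dW → Vec d → Fin dY → ℝ) (𝒢 : Set (Vec dX → Fin dY → ℝ))
    (S : (Fin dY → ℝ) → ℝ≥0) {n : ℕ} (z : Fin n → Obs dX dW) (σ c : ℝ) : Set (Vec d) :=
  {θ | θ ∈ Θ ∧ ((√(n : ℝ) / √(Real.log n) : ℝ) : EReal) * (ksStat m 𝒢 S z σ θ : EReal)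
    ≤ (c : EReal)}

/-! ### Assumptions -/

/-- `𝒢` is permissible: a jointly measurable family indexed by a standard Borel space. -/
def Permissible (𝒢 : Set (Vec dX → Fin dY → ℝ)) : Prop :=
  ∃ (T : Type) (_ : MeasurableSpace T) (_ : StandardBorelSpace T) (e : T → Vec dX → Fin dY → ℝ),
    Measurable (fun p : T × Vec dX => e p.1 p.2) ∧ Set.range e = 𝒢

/-- `g_j(X) ≥ 0` `P`-a.s. for all `j`, `g ∈ 𝒢` and `P ∈ 𝔓`. -/
def NonnegWeights (𝔓 : Set (ProbabilityMeasure (Obs dX dW)))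
    (𝒢 : Set (Vec dX → Fin dY → ℝ)) : Prop :=
  ∀ P ∈ 𝔓, ∀ g ∈ 𝒢, ∀ j, ∀ᵐ z ∂(P : Measure (Obs dX dW)), 0 ≤ g z.1 j

/-- `|m_j(W, θ) g_j(X)| ≤ Ybar` `P`-a.s. for all `j`, `θ ∈ Θ`, `g ∈ 𝒢` and `P ∈ 𝔓`. -/
def BoundedMoments (𝔓 : Set (ProbabilityMeasure (Obs dX dW))) (Θ : Set (Vec d))
    (m : Vec dW → Vec d → Fin dY → ℝ) (𝒢 : Set (Vec dX → Fin dY → ℝ)) (Ybar : ℝ) : Prop :=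
  ∀ P ∈ 𝔓, ∀ θ ∈ Θ, ∀ g ∈ 𝒢, ∀ j,
    ∀ᵐ z ∂(P : Measure (Obs dX dW)), |moment m θ g j z| ≤ Ybar

/-- The class of functions `s m_j(w, θ) g_j(x) + t` with `θ ∈ Θ`, `g ∈ 𝒢` and
`s, t ∈ [-(Ybar ∨ 1), Ybar ∨ 1]`. -/
def momentClass (Θ : Set (Vec d)) (m : Vec dW → Vec d → Fin dY → ℝ)
    (𝒢 : Set (Vec dX → Fin dY → ℝ)) (Ybar : ℝ) (j : Fin dY) : Set (Obs dX dW → ℝ) :=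
  {f | ∃ θ ∈ Θ, ∃ g ∈ 𝒢, ∃ s ∈ Set.Icc (-max Ybar 1) (max Ybar 1),
    ∃ t ∈ Set.Icc (-max Ybar 1) (max Ybar 1), f = fun z => s * moment m θ g j z + t}

/-- The squares of the functions in `momentClass`. -/
def momentClassSq (Θ : Set (Vec d)) (m : Vec dW → Vec d → Fin dY → ℝ)
    (𝒢 : Set (Vec dX → Fin dY → ℝ)) (Ybar : ℝ) (j : Fin dY) : Set (Obs dX dW → ℝ) :=
  {f | ∃ h ∈ momentClass Θ m 𝒢 Ybar j, f = fun z => h z ^ 2}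

/-- The uniform covering number bound `N(ε, F, L₁(Q)) ≤ A ε^{-V}`, for `0 < ε < 1` and all
probability measures `Q` on the sample space `D`, for both classes and every `j`. -/
def PolynomialCovering (D : Set (Obs dX dW)) (Θ : Set (Vec d))
    (m : Vec dW → Vec d → Fin dY → ℝ) (𝒢 : Set (Vec dX → Fin dY → ℝ)) (Ybar A V : ℝ) : Prop :=
  ∀ j, ∀ Q : Measure (Obs dX dW), IsProbabilityMeasure Q → Q Dᶜ = 0 →
    ∀ ε : ℝ, 0 < ε → ε < 1 →
      (coveringNumberL1 ε (momentClass Θ m 𝒢 Ybar j) Q : ℝ≥0∞) ≤ ENNReal.ofReal (A * ε ^ (-V)) ∧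
      (coveringNumberL1 ε (momentClassSq Θ m 𝒢 Ybar j) Q : ℝ≥0∞) ≤ ENNReal.ofReal (A * ε ^ (-V))

/-- The condition on the function `S`, with constants `K₁`, `K₂`. -/
def ScaleFunction (S : (Fin dY → ℝ) → ℝ≥0) (K₁ K₂ : ℝ) : Prop :=
  (∀ t, 0 < S t ↔ ∃ j, t j < 0) ∧
  ∀ c : ℝ, 0 < c → ∀ t,
    (c ≤ S t → ∃ j, t j ≤ -(c * K₁)) ∧ ((S t : ℝ) ≤ c → ∀ j, -(c * K₂) ≤ t j)

/-- Parameters at distance more than `ε` from the identified set violate some unconditional moment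
inequality by at least `δ`, uniformly in `P`. -/
def ConsistencyCondition (𝔓 : Set (ProbabilityMeasure (Obs dX dW))) (Θ : Set (Vec d))
    (m : Vec dW → Vec d → Fin dY → ℝ) (𝒢 : Set (Vec dX → Fin dY → ℝ)) : Prop :=
  ∀ ε : ℝ, 0 < ε → ∃ δ : ℝ, 0 < δ ∧ ∀ P ∈ 𝔓, ∀ θ ∈ Θ,
    ENNReal.ofReal ε < Metric.infEDist θ (identifiedSet Θ m (P : Measure (Obs dX dW))) →
      ∃ g ∈ 𝒢, ∃ j, popMean (P : Measure (Obs dX dW)) (moment m θ g j) < -δ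

/-- The polynomial minorant condition: for `P ∈ 𝔓` and `θ ∈ Θ` whose distance `r` to the identified
set satisfies `0 < r ≤ δ`,
`inf_{g,j} μ_{P,j}(θ,g) / (σ_{P,j}(θ,g) ∨ r^{ψ/γ}) ≤ -C r^{1/γ}`,
the infimum being taken in the extended reals. -/
def PolynomialMinorant (𝔓 : Set (ProbabilityMeasure (Obs dX dW))) (Θ : Set (Vec d))
    (m : Vec dW → Vec d → Fin dY → ℝ) (𝒢 : Set (Vec dX → Fin dY → ℝ)) (C ψ γ δ : ℝ) : Prop :=
  ∀ P ∈ 𝔓, ∀ θ ∈ Θ, ∀ r : ℝ, 0 < r → r ≤ δ →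
    Metric.infEDist θ (identifiedSet Θ m (P : Measure (Obs dX dW))) = ENNReal.ofReal r →
      (⨅ g ∈ 𝒢, ⨅ j, ((popMean (P : Measure (Obs dX dW)) (moment m θ g j) /
        max (popSd (P : Measure (Obs dX dW)) (moment m θ g j)) (r ^ (ψ / γ)) : ℝ) : EReal))
        ≤ ((-(C * r ^ (1 / γ)) : ℝ) : EReal)

end Model

end KSRegion

end

/-! Write `l = √(log n / n)`. The proof isolates one event of uniformly high probability,
`GoodSample` for all `θ`, `g`, `j` at once, and argues deterministically on it.

On a good sample the deviation of the sample mean is self-normalized: its square is below a constant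
times `l² (σ̂² + dev²)` or below a constant times `l⁴`. These constants depend only on `V` and
`Ybar`. For small `l` the `dev²` on the right is absorbed. As `σ_n ≥ K l`, the studentized deviation
is then below `K K₁ l` once `K` exceeds `cutoffConst`, so `Θ₀(P)` lies inside the region
(`mem_region_of_mem_identifiedSet`) and only the other half of the Hausdorff distance matters.

For that half, take `θ` at distance `r` from `Θ₀(P)` and put `q = r^{1/γ}`. The minorant gives some
`μ` below `-(C/2) q (σ ∨ q^ψ)`, while the deviation is `O(l (σ ∨ l))` and the denominator `O(σ ∨
q^ψ)`. If `q > B₁ c l`, the studentized mean is below `-c l K₂` and `θ` is rejected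
(`studentized_lt_of_minorant`); hence `r ≤ (B₁ c l)^γ` on the region. Points farther than `δ` are
rejected by the consistency condition (`studentized_lt_of_mean_lt`).

The good event is obtained by symmetrization. A second sample reduces the claim to differences of
two samples (`measure_exists_le_two_mul`). Random exchanges turn these into Rademacher sums, whose
self-normalized tails are sub-Gaussian without any variance bound. A union bound over a net of `A
n^{4V}` functions finishes the estimate (`measure_exists_selfNormalized_le`). Thus `A` enters the
probability bound and, through the envelope on `D`, the constant `B`, but not `K₀`. Suprema over
uncountable families are handled by measurable projection: the bad two-sample events are projections
of Borel sets, hence null-measurable. -/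

/-! ### Analytic sets are universally measurable -/

namespace MeasureTheory

/-- Inner approximation of the continuous image of the Baire space by compact sets. -/
theorem exists_isCompact_subset_range_of_lt_measure {α : Type*} [TopologicalSpace α]
    [TopologicalSpace.MetrizableSpace α] [MeasurableSpace α] [BorelSpace α] (μ : Measure α)
    [IsFiniteMeasure μ] {f : (ℕ → ℕ) → α} (hf : Continuous f) {b : ℝ≥0∞}
    (hb : b < μ (Set.range f)) :
    ∃ K, IsCompact K ∧ K ⊆ Set.range f ∧ b ≤ μ K := by
  let := TopologicalSpace.metrizableSpaceMetric α
  -- By continuity from below of the outer measure, the `m`-th coordinate can be bounded while the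
  -- image keeps measure above `b`.
  have step : ∀ (m : ℕ) (A : {A : Set (ℕ → ℕ) // b < μ (f '' A)}),
      ∃ k : ℕ, b < μ (f '' (A.1 ∩ {x | x m ≤ k})) := by
    intro m A
    have hU : f '' A.1 = ⋃ k : ℕ, f '' (A.1 ∩ {x | x m ≤ k}) := by
      rw [← Set.image_iUnion, ← Set.inter_iUnion]
      congr 1
      ext x
      simp only [Set.mem_inter_iff, Set.mem_iUnion, Set.mem_ofPred_eq, iff_self_and]
      exact fun _ => ⟨x m, le_rfl⟩
    have hmono : Monotone fun k : ℕ => f '' (A.1 ∩ {x | x m ≤ k}) := fun k l hkl =>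
      Set.image_mono (Set.inter_subset_inter_right _ fun x (hx : x m ≤ k) => hx.trans hkl)
    have h := A.2
    rw [hU, hmono.measure_iUnion] at h
    exact lt_iSup_iff.1 h
  choose k hk using step
  let A : ℕ → {A : Set (ℕ → ℕ) // b < μ (f '' A)} := fun m =>
    Nat.rec ⟨Set.univ, by simpa using hb⟩ (fun m A => ⟨A.1 ∩ {x | x m ≤ k m A}, hk m A⟩) m
  have hA : ∀ m, (A (m + 1)).1 = (A m).1 ∩ {x | x m ≤ k m (A m)} := fun m => rfl
  have hanti : Antitone fun m => (A m).1 := antitone_nat_of_succ_le fun m => by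
    rw [hA]; exact Set.inter_subset_left
  have hbound : ∀ m, ∀ x ∈ (A m).1, ∀ i < m, x i ≤ k i (A i) := by
    intro m x hx i hi
    have h : x ∈ (A (i + 1)).1 := hanti (Nat.succ_le_of_lt hi) hx
    rw [hA] at h
    exact h.2
  set C : Set (ℕ → ℕ) := Set.univ.pi fun i => Set.Iic (k i (A i)) with hC
  have hCc : IsCompact C := isCompact_univ_pi fun i => (Set.finite_Iic _).isCompact
  have hKc : IsCompact (f '' C) := hCc.image hf
  refine ⟨f '' C, hKc, Set.image_subset_range _ _, ?_⟩
  have hsub : (⋂ m, closure (f '' (A m).1)) ⊆ f '' C := by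
    intro y hy
    rw [Set.mem_iInter] at hy
    have hx : ∀ m : ℕ, ∃ x ∈ (A m).1, dist y (f x) < 1 / ((m : ℝ) + 1) := by
      intro m
      obtain ⟨_, ⟨x, hx, rfl⟩, hd⟩ := Metric.mem_closure_iff.1 (hy m) (1 / ((m : ℝ) + 1))
        (by positivity)
      exact ⟨x, hx, hd⟩
    choose x hxA hxd using hx
    -- Only the first `m` coordinates of `x m` are known to be bounded. Zeroing the others puts the
    -- point in the compact box `C` and does not affect coordinatewise limits.
    let x' : ℕ → ℕ → ℕ := fun m i => if i < m then x m i else 0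
    have hx' : ∀ m, x' m ∈ C := by
      intro m i _
      simp only [x', Set.mem_Iic]
      split_ifs with hi
      · exact hbound m _ (hxA m) i hi
      · exact Nat.zero_le _
    obtain ⟨z, hzC, φ, hφ, hlim⟩ := hCc.tendsto_subseq hx'
    have hlim' : Tendsto (fun m => x (φ m)) atTop (𝓝 z) := by
      rw [tendsto_pi_nhds] at hlim ⊢
      intro i
      refine (hlim i).congr' ?_
      filter_upwards [eventually_gt_atTop i] with m hm
      simp [x', hm.trans_le (hφ.id_le m)]
    have h1 : Tendsto (fun m => f (x (φ m))) atTop (𝓝 (f z)) := (hf.tendsto z).comp hlim'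
    have h2 : Tendsto (fun m => f (x (φ m))) atTop (𝓝 y) := by
      rw [tendsto_iff_dist_tendsto_zero]
      refine squeeze_zero (fun _ => dist_nonneg) (fun m => ?_)
        (tendsto_one_div_add_atTop_nhds_zero_nat.comp hφ.tendsto_atTop)
      rw [dist_comm]
      exact (hxd (φ m)).le
    exact ⟨z, hzC, tendsto_nhds_unique h1 h2⟩
  calc b ≤ ⨅ m, μ (closure (f '' (A m).1)) :=
        le_iInf fun m => ((A m).2.trans_le (measure_mono subset_closure)).le
    _ = μ (⋂ m, closure (f '' (A m).1)) := by
        rw [Antitone.measure_iInter (fun m n h => closure_mono (Set.image_mono (hanti h)))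
          (fun m => isClosed_closure.measurableSet.nullMeasurableSet) ⟨0, measure_ne_top _ _⟩]
    _ ≤ μ (f '' C) := measure_mono hsub

/-- An analytic set is measurable with respect to the completion of every finite Borel measure. -/
theorem AnalyticSet.nullMeasurableSet {α : Type*} [TopologicalSpace α]
    [TopologicalSpace.MetrizableSpace α] [MeasurableSpace α] [BorelSpace α] {s : Set α}
    (hs : AnalyticSet s) (μ : Measure α) [IsFiniteMeasure μ] : NullMeasurableSet s μ := by
  rw [AnalyticSet] at hs
  rcases hs with rfl | ⟨f, hf, rfl⟩
  · exact MeasurableSet.empty.nullMeasurableSet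
  rcases eq_or_ne (μ (Set.range f)) 0 with h0 | h0
  · exact NullMeasurableSet.of_null h0
  obtain ⟨b, -, hb, hlim⟩ := exists_seq_strictMono_tendsto' (pos_iff_ne_zero.2 h0)
  choose K hKc hKs hK using fun n =>
    exists_isCompact_subset_range_of_lt_measure μ hf (hb n).2
  have hm : MeasurableSet (⋃ n, K n) := MeasurableSet.iUnion fun n => (hKc n).measurableSet
  have hle : μ (Set.range f) ≤ μ (⋃ n, K n) :=
    le_of_tendsto' hlim fun n => (hK n).trans (measure_mono (Set.subset_iUnion K n))
  exact hm.nullMeasurableSet.congr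
    (ae_eq_of_subset_of_measure_ge (Set.iUnion_subset hKs) hle hm.nullMeasurableSet
      (measure_ne_top _ _))

/-- The projection of a measurable subset of a product of standard Borel spaces is measurable with
respect to the completion of every finite measure. -/
theorem nullMeasurableSet_exists {I α : Type*} [MeasurableSpace I] [StandardBorelSpace I]
    [MeasurableSpace α] [StandardBorelSpace α] {p : I → α → Prop}
    (hp : MeasurableSet {x : I × α | p x.1 x.2}) (μ : Measure α) [IsFiniteMeasure μ] :
    NullMeasurableSet {a | ∃ i, p i a} μ := by
  let := upgradeStandardBorel α
  have h : AnalyticSet (Prod.snd '' {x : I × α | p x.1 x.2}) :=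
    hp.analyticSet_image measurable_snd
  convert h.nullMeasurableSet μ using 1
  ext a
  simp

end MeasureTheory

/-! ### Symmetrization -/

namespace KSRegion

/-- The Rademacher sign attached to a Boolean. -/
def rsign (b : Bool) : ℝ := if b then -1 else 1

theorem rsign_sq (b : Bool) : rsign b ^ 2 = 1 := by cases b <;> simp [rsign]

/-- The sum over sign patterns factorizes over coordinates, and each factor is controlled by `cosh x
≤ exp (x² / 2)`. -/
theorem sum_exp_rademacher_le {n : ℕ} (a : Fin n → ℝ) (l : ℝ) :
    ∑ ε : Fin n → Bool, Real.exp (l * ∑ j, rsign (ε j) * a j) ≤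
      2 ^ n * Real.exp (l ^ 2 * (∑ j, a j ^ 2) / 2) := by
  have h1 : ∀ ε : Fin n → Bool, Real.exp (l * ∑ j, rsign (ε j) * a j) =
      ∏ j, Real.exp (l * (rsign (ε j) * a j)) := fun ε => by
    rw [Finset.mul_sum, Real.exp_sum]
  simp_rw [h1]
  rw [← Fintype.piFinset_univ, ← Finset.prod_univ_sum (fun _ => Finset.univ)
    (fun (j : Fin n) (b : Bool) => Real.exp (l * (rsign b * a j)))]
  have h2 : ∀ j : Fin n, ∑ b : Bool, Real.exp (l * (rsign b * a j)) ≤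
      2 * Real.exp (l ^ 2 * a j ^ 2 / 2) := by
    intro j
    have h := Real.cosh_le_exp_half_sq (l * a j)
    rw [Real.cosh_eq] at h
    rw [Fintype.sum_bool]
    simp only [rsign, if_true, Bool.false_eq_true, if_false]
    have e1 : l * (-1 * a j) = -(l * a j) := by ring
    have e2 : l * (1 * a j) = l * a j := by ring
    have e3 : (l * a j) ^ 2 / 2 = l ^ 2 * a j ^ 2 / 2 := by ring
    rw [e1, e2]
    rw [e3] at h
    linarith
  calc ∏ j, ∑ b : Bool, Real.exp (l * (rsign b * a j))
      ≤ ∏ j : Fin n, 2 * Real.exp (l ^ 2 * a j ^ 2 / 2) :=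
        Finset.prod_le_prod (fun j _ => Finset.sum_nonneg fun _ _ => (Real.exp_pos _).le)
          fun j _ => h2 j
    _ = 2 ^ n * Real.exp (l ^ 2 * (∑ j, a j ^ 2) / 2) := by
        rw [Finset.prod_mul_distrib, ← Real.exp_sum, Finset.prod_const, Finset.card_univ,
          Fintype.card_fin, Finset.mul_sum, Finset.sum_div]

theorem card_le_rademacher {n : ℕ} (a : Fin n → ℝ) {s : ℝ} (hs : 0 ≤ s)
    (hQ : 0 < ∑ j, a j ^ 2) :
    ((Finset.univ.filter fun ε : Fin n → Bool => s ≤ ∑ j, rsign (ε j) * a j).card : ℝ) ≤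
      2 ^ n * Real.exp (-(s ^ 2 / (2 * ∑ j, a j ^ 2))) := by
  set Q := ∑ j, a j ^ 2 with hQd
  -- Chernoff bound at the minimizer of `l² Q / 2 - l s`.
  set l := s / Q with hl
  have hl0 : 0 ≤ l := div_nonneg hs hQ.le
  have h1 : ((Finset.univ.filter fun ε : Fin n → Bool => s ≤ ∑ j, rsign (ε j) * a j).card : ℝ) *
      Real.exp (l * s) ≤ 2 ^ n * Real.exp (l ^ 2 * Q / 2) := by
    refine le_trans ?_ (sum_exp_rademacher_le a l)
    rw [← nsmul_eq_mul, ← Finset.sum_const]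
    refine le_trans (Finset.sum_le_sum fun ε hε => ?_)
      (Finset.sum_le_sum_of_subset_of_nonneg (Finset.filter_subset _ _)
        fun _ _ _ => (Real.exp_pos _).le)
    exact Real.exp_le_exp.2 (mul_le_mul_of_nonneg_left (Finset.mem_filter.1 hε).2 hl0)
  rw [← le_div_iff₀ (Real.exp_pos _), mul_div_assoc, ← Real.exp_sub] at h1
  refine h1.trans_eq ?_
  congr 2
  rw [hl]
  field_simp
  ring

/-- The tail of a self-normalized Rademacher sum. -/
theorem card_rademacher_selfNormalized_le {n : ℕ} (a : Fin n → ℝ) {R : ℝ} (hR : 0 ≤ R) :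
    ((Finset.univ.filter fun ε : Fin n → Bool => (∑ j, rsign (ε j) * a j) ≠ 0 ∧
      R * ∑ j, a j ^ 2 ≤ (∑ j, rsign (ε j) * a j) ^ 2).card : ℝ) ≤
      2 ^ n * (2 * Real.exp (-(R / 2))) := by
  have hQ0 : 0 ≤ ∑ j, a j ^ 2 := Finset.sum_nonneg fun _ _ => sq_nonneg _
  rcases hQ0.eq_or_lt with hQ | hQ
  -- Without the clause that the sum is nonzero, `a = 0` would satisfy the inequality for every sign
  -- pattern.
  · have ha : ∀ j, a j = 0 := fun j => by
      have := (Finset.sum_eq_zero_iff_of_nonneg fun j _ => sq_nonneg (a j)).1 hQ.symm j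
        (Finset.mem_univ j)
      exact pow_eq_zero_iff two_ne_zero |>.1 this
    simp only [ha, mul_zero, Finset.sum_const_zero, ne_eq, not_true_eq_false, false_and,
      Finset.filter_false, Finset.card_empty, Nat.cast_zero]
    positivity
  · set s := √(R * ∑ j, a j ^ 2) with hs
    have hs2 : s ^ 2 = R * ∑ j, a j ^ 2 := Real.sq_sqrt (by positivity)
    have he : s ^ 2 / (2 * ∑ j, a j ^ 2) = R / 2 := by
      rw [hs2]; field_simp
    have h1 := card_le_rademacher a (Real.sqrt_nonneg _ : 0 ≤ s) hQ
    have h2 := card_le_rademacher (fun j => - a j) (Real.sqrt_nonneg _ : 0 ≤ s)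
      (by simpa using hQ)
    simp only [neg_sq] at h2
    rw [he] at h1 h2
    have hsub : (Finset.univ.filter fun ε : Fin n → Bool => (∑ j, rsign (ε j) * a j) ≠ 0 ∧
        R * ∑ j, a j ^ 2 ≤ (∑ j, rsign (ε j) * a j) ^ 2) ⊆
        (Finset.univ.filter fun ε : Fin n → Bool => s ≤ ∑ j, rsign (ε j) * a j) ∪
        (Finset.univ.filter fun ε : Fin n → Bool => s ≤ ∑ j, rsign (ε j) * - a j) := by
      intro ε hε
      have h := (Finset.mem_filter.1 hε).2.2
      simp only [Finset.mem_union, Finset.mem_filter, Finset.mem_univ, true_and, mul_neg,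
        Finset.sum_neg_distrib]
      exact le_abs.1 (Real.sqrt_le_sqrt h |>.trans_eq (Real.sqrt_sq_eq_abs _))
    have h3 : ((Finset.univ.filter fun ε : Fin n → Bool => (∑ j, rsign (ε j) * a j) ≠ 0 ∧
        R * ∑ j, a j ^ 2 ≤ (∑ j, rsign (ε j) * a j) ^ 2).card : ℝ) ≤
        ((Finset.univ.filter fun ε : Fin n → Bool => s ≤ ∑ j, rsign (ε j) * a j).card : ℝ) +
        ((Finset.univ.filter fun ε : Fin n → Bool => s ≤ ∑ j, rsign (ε j) * - a j).card : ℝ) := by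
      exact_mod_cast (Finset.card_le_card hsub).trans (Finset.card_union_le _ _)
    linarith

/-- Exchange the two copies of the observations flagged by `ε`. -/
def swapPairs {Z : Type*} {n : ℕ} (ε : Fin n → Bool) (w : Fin n → Z × Z) : Fin n → Z × Z :=
  fun j => (if ε j then Prod.swap else id) (w j)

theorem sub_swapPairs {Z : Type*} {n : ℕ} (ε : Fin n → Bool) (w : Fin n → Z × Z) (f : Z → ℝ) (j : Fin n) :
    f (swapPairs ε w j).1 - f (swapPairs ε w j).2 =
      rsign (ε j) * (f (w j).1 - f (w j).2) := by
  unfold swapPairs rsign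
  split_ifs <;> simp

/-! ### Exchangeability of paired samples and the introduction of random signs. -/

section Swap

variable {Z : Type*} [MeasurableSpace Z]

theorem measurePreserving_swapPairs {n : ℕ} (ε : Fin n → Bool) (P : Measure Z)
    [IsProbabilityMeasure P] :
    MeasurePreserving (swapPairs ε) (Measure.pi fun _ : Fin n => P.prod P)
      (Measure.pi fun _ : Fin n => P.prod P) := by
  refine measurePreserving_pi _ _ fun j => ?_
  split_ifs
  · exact Measure.measurePreserving_swap
  · exact MeasurePreserving.id _

/-- Every exchange preserves the law of the paired sample, so `2 ^ n` times the measure of `F` is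
the integral of the number of exchanges that bring `w` into `F`. A pointwise count therefore bounds
the measure. -/
theorem measure_le_of_card_swapPairs_le {n : ℕ} (P : Measure Z) [IsProbabilityMeasure P]
    {F : Set (Fin n → Z × Z)}
    (hF : NullMeasurableSet F (Measure.pi fun _ : Fin n => P.prod P)) {β : ℝ}
    [∀ w, DecidablePred fun ε : Fin n → Bool => swapPairs ε w ∈ F]
    (h : ∀ᵐ w ∂(Measure.pi fun _ : Fin n => P.prod P),
      ((Finset.univ.filter fun ε : Fin n → Bool => swapPairs ε w ∈ F).card : ℝ) ≤ 2 ^ n * β) :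
    (Measure.pi fun _ : Fin n => P.prod P) F ≤ ENNReal.ofReal β := by
  set ν := Measure.pi fun _ : Fin n => P.prod P with hν
  have hpre : ∀ ε : Fin n → Bool, NullMeasurableSet (swapPairs ε ⁻¹' F) ν := fun ε =>
    hF.preimage (measurePreserving_swapPairs ε P).quasiMeasurePreserving
  have h1 : (2 ^ n : ℝ≥0∞) * ν F = ∑ ε : Fin n → Bool, ν (swapPairs ε ⁻¹' F) := by
    rw [Finset.sum_congr rfl fun ε _ => (measurePreserving_swapPairs ε P).measure_preimage hF]
    simp [hν]
  have h2 : ∑ ε : Fin n → Bool, ν (swapPairs ε ⁻¹' F) =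
      ∫⁻ w, ∑ ε : Fin n → Bool, (swapPairs ε ⁻¹' F).indicator 1 w ∂ν := by
    rw [lintegral_finsetSum' _ fun ε _ => ?_]
    · exact Finset.sum_congr rfl fun ε _ => (lintegral_indicator_one₀ (hpre ε)).symm
    · exact aemeasurable_one.indicator₀ (hpre ε)
  have h3 : ∫⁻ w, ∑ ε : Fin n → Bool, (swapPairs ε ⁻¹' F).indicator 1 w ∂ν ≤
      ∫⁻ _, ENNReal.ofReal (2 ^ n * β) ∂ν := by
    refine lintegral_mono_ae ?_
    filter_upwards [h] with w hw
    have : ∑ ε : Fin n → Bool, (swapPairs ε ⁻¹' F).indicator (1 : (Fin n → Z × Z) → ℝ≥0∞) w =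
        ((Finset.univ.filter fun ε : Fin n → Bool => swapPairs ε w ∈ F).card : ℝ≥0∞) := by
      rw [Finset.card_filter, Nat.cast_sum]
      refine Finset.sum_congr rfl fun ε _ => ?_
      by_cases hε : swapPairs ε w ∈ F
      · rw [if_pos hε, Set.indicator_of_mem (show w ∈ swapPairs ε ⁻¹' F from hε)]
        simp
      · rw [if_neg hε, Set.indicator_of_notMem (show w ∉ swapPairs ε ⁻¹' F from hε)]
        simp
    rw [this, ← ENNReal.ofReal_natCast]
    exact ENNReal.ofReal_le_ofReal hw
  rw [h2.symm.trans h1.symm, lintegral_const, measure_univ, mul_one,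
    ENNReal.ofReal_mul (by positivity), ENNReal.ofReal_pow (by norm_num),
    ENNReal.ofReal_ofNat] at h3
  exact (ENNReal.mul_le_mul_iff_right (by simp) (by simp)).1 h3

/-- The first symmetrization step: a random index chosen from the first sample is, with
probability at least one half, typical for the second sample. -/
theorem measure_exists_le_two_mul {n : ℕ} (P : Measure Z) [IsProbabilityMeasure P]
    {J : Type*} (M N : J → (Fin n → Z) → Prop)
    (hN : ∀ i z, M i z → (Measure.pi fun _ : Fin n => P) {z' | ¬ N i z'} ≤ 1 / 2)
    {F : Set (Fin n → Z × Z)}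
    (hF : ∀ w : Fin n → Z × Z, ∀ i, M i (fun j => (w j).1) → N i (fun j => (w j).2) → w ∈ F) :
    (Measure.pi fun _ : Fin n => P) {z | ∃ i, M i z} ≤
      2 * (Measure.pi fun _ : Fin n => P.prod P) F := by
  set μ := Measure.pi fun _ : Fin n => P with hμ
  set e := MeasurableEquiv.arrowProdEquivProdArrow Z Z (Fin n)
  have he : MeasurePreserving e (Measure.pi fun _ : Fin n => P.prod P) (μ.prod μ) :=
    measurePreserving_arrowProdEquivProdArrow Z Z (Fin n) (fun _ => P) (fun _ => P)
  have h1 : (Measure.pi fun _ : Fin n => P.prod P) F = (μ.prod μ) (e.symm ⁻¹' F) := by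
    rw [← he.measure_preimage_equiv, ← Set.preimage_comp]
    simp
  -- `F` is arbitrary; its measurable hull for the product measure makes Fubini and Markov available
  -- at no cost in measure.
  set F' := toMeasurable (μ.prod μ) (e.symm ⁻¹' F) with hF'
  have hF'm : MeasurableSet F' := measurableSet_toMeasurable _ _
  rw [h1, ← measure_toMeasurable (μ := μ.prod μ), ← hF', Measure.prod_apply hF'm]
  have hmeas : Measurable fun z => μ (Prod.mk z ⁻¹' F') := measurable_measure_prodMk_left hF'm
  have h2 : {z | ∃ i, M i z} ⊆ {z | 1 / 2 ≤ μ (Prod.mk z ⁻¹' F')} := by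
    rintro z ⟨i, hi⟩
    have hsub : {z' | N i z'} ⊆ Prod.mk z ⁻¹' F' := fun z' hz' =>
      subset_toMeasurable _ _ (hF (e.symm (z, z')) i hi hz')
    have h3 : (1 : ℝ≥0∞) ≤ μ (Prod.mk z ⁻¹' F') + 1 / 2 := by
      calc (1 : ℝ≥0∞) = μ Set.univ := by simp [hμ]
        _ ≤ μ ({z' | N i z'} ∪ {z' | ¬ N i z'}) := measure_mono fun z' _ => em _
        _ ≤ μ {z' | N i z'} + μ {z' | ¬ N i z'} := measure_union_le _ _
        _ ≤ _ := add_le_add (measure_mono hsub) (hN i z hi)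
    change 1 / 2 ≤ μ (Prod.mk z ⁻¹' F')
    have h4 : (1 / 2 : ℝ≥0∞) + 1 / 2 ≤ μ (Prod.mk z ⁻¹' F') + 1 / 2 := by
      rwa [ENNReal.add_halves]
    exact (ENNReal.add_le_add_iff_right (by simp)).1 h4
  have h5 := mul_meas_ge_le_lintegral (μ := μ) hmeas (1 / 2)
  calc μ {z | ∃ i, M i z} ≤ μ {z | 1 / 2 ≤ μ (Prod.mk z ⁻¹' F')} := measure_mono h2
    _ = 2 * (1 / 2 * μ {z | 1 / 2 ≤ μ (Prod.mk z ⁻¹' F')}) := by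
        rw [← mul_assoc, one_div, ENNReal.mul_inv_cancel (by simp) (by simp), one_mul]
    _ ≤ _ := by gcongr

end Swap

/-- The elementary perturbation bound behind the passage to a finite net. -/
theorem selfNormalized_perturb {n : ℕ} {a b : Fin n → ℝ} {η R : ℝ} (hR : 0 ≤ R)
    (hab : ∀ j, |b j - a j| ≤ 2 * η) (hn : n * η ≤ 1 / 4) (hRn : R * (n * η ^ 2) ≤ 1 / 4)
    (h1 : 1 ≤ |∑ j, a j|) (h2 : R * ∑ j, a j ^ 2 ≤ (∑ j, a j) ^ 2) :
    (∑ j, b j) ≠ 0 ∧ (R / 16) * ∑ j, b j ^ 2 ≤ (∑ j, b j) ^ 2 := by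
  have hd : |∑ j, b j - ∑ j, a j| ≤ 1 / 2 := by
    rw [← Finset.sum_sub_distrib]
    calc |∑ j, (b j - a j)| ≤ ∑ j, |b j - a j| := Finset.abs_sum_le_sum_abs _ _
      _ ≤ ∑ _j : Fin n, 2 * η := Finset.sum_le_sum fun j _ => hab j
      _ = 2 * (n * η) := by simp; ring
      _ ≤ 1 / 2 := by linarith
  set s := ∑ j, a j
  set t := ∑ j, b j
  have hts : |s| / 2 ≤ |t| := by
    have := abs_sub_abs_le_abs_sub s t
    rw [abs_sub_comm] at this
    linarith
  have hq : ∑ j, b j ^ 2 ≤ 2 * ∑ j, a j ^ 2 + 8 * (n * η ^ 2) := by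
    have : ∀ j, b j ^ 2 ≤ 2 * a j ^ 2 + 8 * η ^ 2 := fun j => by
      have h := sq_le_sq' (neg_le_of_abs_le (hab j)) (le_of_abs_le (hab j))
      nlinarith [sq_nonneg (b j - 2 * a j)]
    refine (Finset.sum_le_sum fun j _ => this j).trans_eq ?_
    rw [Finset.sum_add_distrib, ← Finset.mul_sum]
    simp
    ring
  have hs2 : 1 ≤ s ^ 2 := by
    rw [← sq_abs]; nlinarith
  have ht2 : s ^ 2 / 4 ≤ t ^ 2 := by
    rw [← sq_abs s, ← sq_abs t]; nlinarith [abs_nonneg s]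
  refine ⟨fun h0 => ?_, ?_⟩
  · rw [h0] at ht2
    norm_num at ht2
    linarith
  -- With `R / 16` the two terms of `hq` contribute at most `s² / 8` and `1 / 8 ≤ s² / 8`, together
  -- `s² / 4 ≤ t²`.
  · have := mul_le_mul_of_nonneg_left hq (by positivity : 0 ≤ R / 16)
    nlinarith

/-! ### Union bound over a net for symmetrized self-normalized sums. -/

section SelfNormalized

variable {Z I : Type*} [MeasurableSpace Z] [StandardBorelSpace Z] [MeasurableSpace I]
  [StandardBorelSpace I]

/-- Finite sup-norm nets at every configuration of `N` points of `D`. -/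
def HasNets (D : Set Z) (u : I → Z → ℝ) (N : ℕ) (η κ : ℝ) : Prop :=
  ∀ w : Fin N → Z, (∀ j, w j ∈ D) →
    ∃ J : Finset I, (J.card : ℝ) ≤ κ ∧ ∀ i, ∃ k ∈ J, ∀ j, |u i (w j) - u k (w j)| ≤ η

/-- The maximal inequality for self-normalized differences of two samples. -/
theorem measure_exists_selfNormalized_le {n : ℕ} (P : Measure Z) [IsProbabilityMeasure P]
    {D : Set Z} (hD : P Dᶜ = 0) {u : I → Z → ℝ} (hu : Measurable fun p : I × Z => u p.1 p.2)
    {η κ R : ℝ} (hnet : HasNets D u (n + n) η κ) (hR : 0 ≤ R)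
    (hn : n * η ≤ 1 / 4) (hRn : R * (n * η ^ 2) ≤ 1 / 4) :
    (Measure.pi fun _ : Fin n => P.prod P)
      {w | ∃ i, 1 ≤ |∑ j, (u i (w j).1 - u i (w j).2)| ∧
        R * ∑ j, (u i (w j).1 - u i (w j).2) ^ 2 ≤ (∑ j, (u i (w j).1 - u i (w j).2)) ^ 2} ≤
      ENNReal.ofReal (κ * (2 * Real.exp (-(R / 32)))) := by
  classical
  have hm : ∀ j : Fin n, Measurable fun x : I × (Fin n → Z × Z) =>
      u x.1 (x.2 j).1 - u x.1 (x.2 j).2 := fun j =>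
    (hu.comp (measurable_fst.prodMk (by fun_prop : Measurable
      fun x : I × (Fin n → Z × Z) => (x.2 j).1))).sub
    (hu.comp (measurable_fst.prodMk (by fun_prop : Measurable
      fun x : I × (Fin n → Z × Z) => (x.2 j).2)))
  refine measure_le_of_card_swapPairs_le P (nullMeasurableSet_exists ?_ _) ?_
  · have hs : Measurable fun x : I × (Fin n → Z × Z) =>
        ∑ j, (u x.1 (x.2 j).1 - u x.1 (x.2 j).2) :=
      Finset.measurable_sum _ fun j _ => hm j
    have hq : Measurable fun x : I × (Fin n → Z × Z) =>
        ∑ j, (u x.1 (x.2 j).1 - u x.1 (x.2 j).2) ^ 2 :=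
      Finset.measurable_sum _ fun j _ => (hm j).pow_const 2
    exact (measurableSet_le measurable_const hs.abs).inter
      (measurableSet_le (hq.const_mul R) (hs.pow_const 2))
  · have hD2 : ∀ᵐ p ∂(P.prod P), p.1 ∈ D ∧ p.2 ∈ D := by
      have h : ∀ᵐ z ∂P, z ∈ D := hD
      exact (Measure.quasiMeasurePreserving_fst.ae h).and (Measure.quasiMeasurePreserving_snd.ae h)
    have hDn : ∀ᵐ w ∂(Measure.pi fun _ : Fin n => P.prod P), ∀ j, (w j).1 ∈ D ∧ (w j).2 ∈ D := by
      rw [ae_all_iff]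
      exact fun j => (Measure.quasiMeasurePreserving_eval (fun _ => P.prod P) j).ae hD2
    filter_upwards [hDn] with w hw
    -- The net is taken at all `2n` points together. Exchanges only permute these points, so one net
    -- serves all sign patterns.
    obtain ⟨J, hJ, hcov⟩ := hnet (Fin.append (fun j => (w j).1) (fun j => (w j).2)) (fun j => by
      refine Fin.addCases (fun j => ?_) (fun j => ?_) j
      · rw [Fin.append_left]; exact (hw j).1
      · rw [Fin.append_right]; exact (hw j).2)
    let a : I → Fin n → ℝ := fun i j => u i (w j).1 - u i (w j).2
    let G : I → Finset (Fin n → Bool) := fun k =>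
      Finset.univ.filter fun ε : Fin n → Bool => (∑ j, rsign (ε j) * a k j) ≠ 0 ∧
        (R / 16) * ∑ j, a k j ^ 2 ≤ (∑ j, rsign (ε j) * a k j) ^ 2
    have hsub : (Finset.univ.filter fun ε : Fin n → Bool => swapPairs ε w ∈
        {w : Fin n → Z × Z | ∃ i, 1 ≤ |∑ j, (u i (w j).1 - u i (w j).2)| ∧
        R * ∑ j, (u i (w j).1 - u i (w j).2) ^ 2 ≤ (∑ j, (u i (w j).1 - u i (w j).2)) ^ 2}) ⊆
        J.biUnion G := by
      intro ε hε
      obtain ⟨i, h1, h2⟩ := (Finset.mem_filter.1 hε).2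
      simp only [sub_swapPairs] at h1 h2
      obtain ⟨k, hk, hik⟩ := hcov i
      refine Finset.mem_biUnion.2 ⟨k, hk, Finset.mem_filter.2 ⟨Finset.mem_univ _, ?_⟩⟩
      have := selfNormalized_perturb (a := fun j => rsign (ε j) * a i j)
        (b := fun j => rsign (ε j) * a k j) (η := η) hR (fun j => ?_) hn hRn h1 h2
      · simpa only [mul_pow, rsign_sq, one_mul] using this
      · have e1 := hik (Fin.castAdd n j)
        have e2 := hik (Fin.natAdd n j)
        simp only [Fin.append_left, Fin.append_right] at e1 e2
        have hr : |rsign (ε j)| = 1 := by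
          rw [← sq_eq_sq₀ (abs_nonneg _) zero_le_one, sq_abs, rsign_sq, one_pow]
        rw [← mul_sub, abs_mul, hr, one_mul]
        have : a k j - a i j = -(u i (w j).1 - u k (w j).1) + (u i (w j).2 - u k (w j).2) := by
          simp only [a]; ring
        rw [this]
        refine (abs_add_le _ _).trans ?_
        rw [abs_neg]
        linarith
    calc _ ≤ ((J.biUnion G).card : ℝ) := by exact_mod_cast Finset.card_le_card hsub
      _ ≤ ∑ k ∈ J, ((G k).card : ℝ) := by exact_mod_cast Finset.card_biUnion_le
      _ ≤ ∑ _k ∈ J, 2 ^ n * (2 * Real.exp (-(R / 16 / 2))) :=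
          Finset.sum_le_sum fun k _ => card_rademacher_selfNormalized_le (a k) (by positivity)
      _ = J.card * (2 ^ n * (2 * Real.exp (-(R / 32)))) := by
          rw [Finset.sum_const, nsmul_eq_mul]; ring_nf
      _ ≤ κ * (2 ^ n * (2 * Real.exp (-(R / 32)))) := by gcongr
      _ = _ := by ring

end SelfNormalized

/-! ### Finite nets from uniform covering numbers -/

section Nets

variable {Z : Type*} [MeasurableSpace Z]

theorem exists_finset_of_coveringNumberL1_le {ε r : ℝ} {F : Set (Z → ℝ)} {Q : Measure Z}
    (hr : 0 ≤ r) (h : (coveringNumberL1 ε F Q : ℝ≥0∞) ≤ ENNReal.ofReal r) :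
    ∃ C : Finset (Z → ℝ), (C.card : ℝ) ≤ r ∧
      ∀ f ∈ F, ∃ c ∈ C, ∫⁻ z, ‖f z - c z‖ₑ ∂Q ≤ ENNReal.ofReal ε := by
  have hne : coveringNumberL1 ε F Q ≠ ⊤ := by
    intro h0
    rw [h0] at h
    simp at h
  have hlt : coveringNumberL1 ε F Q < coveringNumberL1 ε F Q + 1 :=
    (ENat.lt_add_one_iff hne).2 le_rfl
  nth_rewrite 1 [coveringNumberL1] at hlt
  simp only [iInf_lt_iff] at hlt
  obtain ⟨C, -, hC, hcard⟩ := hlt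
  refine ⟨C, ?_, hC⟩
  have h1 : (C.card : ℕ∞) ≤ coveringNumberL1 ε F Q := (ENat.lt_add_one_iff hne).1 hcard
  have h2 : ((C.card : ℕ) : ℝ≥0∞) ≤ ENNReal.ofReal r := by
    refine le_trans ?_ h
    exact_mod_cast (ENat.toENNReal_le.2 h1)
  rw [← ENNReal.ofReal_natCast] at h2
  exact (ENNReal.ofReal_le_ofReal_iff hr).1 h2

/-- The polynomial bound on the uniform covering numbers of `F`. -/
def CoverBound (D : Set Z) (F : Set (Z → ℝ)) (A V : ℝ) : Prop :=
  ∀ Q : Measure Z, IsProbabilityMeasure Q → Q Dᶜ = 0 → ∀ ε : ℝ, 0 < ε → ε < 1 →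
    (coveringNumberL1 ε F Q : ℝ≥0∞) ≤ ENNReal.ofReal (A * ε ^ (-V))

variable [MeasurableSingletonClass Z]

/-- Under the uniform measure on the `N` points each point has mass at least `1 / N`, so an `L₁`
error `ε` is a pointwise error at most `N ε`. The factor 2 pays for replacing centers by members of
the family. -/
theorem CoverBound.hasNets {D : Set Z} (hD : MeasurableSet D) {F : Set (Z → ℝ)} {A V : ℝ}
    (hA : 0 ≤ A) (hF : CoverBound D F A V) {I : Type*} {v : I → Z → ℝ} (hv : ∀ i, v i ∈ F)
    {N : ℕ} (hN : 0 < N) {ε : ℝ} (hε : 0 < ε) (hε1 : ε < 1) :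
    HasNets D v N (2 * (N * ε)) (A * ε ^ (-V)) := by
  classical
  intro w hw
  set Q : Measure Z := (N : ℝ≥0∞)⁻¹ • ∑ j, Measure.dirac (w j) with hQ
  have hN' : (N : ℝ≥0∞) ≠ 0 := by exact_mod_cast hN.ne'
  have hQp : IsProbabilityMeasure Q := ⟨by
    simp [hQ, ENNReal.inv_mul_cancel hN' (ENNReal.natCast_ne_top N)]⟩
  have hQD : Q Dᶜ = 0 := by
    simp [hQ, Measure.dirac_apply' _ hD.compl, hw]
  have hr : 0 ≤ A * ε ^ (-V) := mul_nonneg hA (Real.rpow_nonneg hε.le _)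
  obtain ⟨C, hC, hcov⟩ := exists_finset_of_coveringNumberL1_le hr (hF Q hQp hQD ε hε hε1)
  have hpt : ∀ f c : Z → ℝ, ∫⁻ z, ‖f z - c z‖ₑ ∂Q ≤ ENNReal.ofReal ε →
      ∀ j, |f (w j) - c (w j)| ≤ N * ε := by
    intro f c h j
    rw [hQ, lintegral_smul_measure, lintegral_finsetSum_measure] at h
    simp only [lintegral_dirac, smul_eq_mul] at h
    have h1 : ‖f (w j) - c (w j)‖ₑ ≤ N * ENNReal.ofReal ε := by
      rw [mul_comm, ← div_eq_mul_inv, ENNReal.div_le_iff_le_mul (Or.inl hN')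
        (Or.inl (ENNReal.natCast_ne_top N)), mul_comm] at h
      exact (Finset.single_le_sum (f := fun j => ‖f (w j) - c (w j)‖ₑ)
        (fun _ _ => zero_le) (Finset.mem_univ j)).trans h
    rw [← ENNReal.ofReal_natCast, ← ENNReal.ofReal_mul (by positivity),
      Real.enorm_eq_ofReal_abs] at h1
    exact (ENNReal.ofReal_le_ofReal_iff (by positivity)).1 h1
  rcases isEmpty_or_nonempty I with hI | ⟨⟨i₀⟩⟩
  · exact ⟨∅, by simpa using hr, fun i => (hI.false i).elim⟩
  -- Centers need not belong to the family. Those with no member nearby are sent to the arbitrary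
  -- index `i₀` and are never used.
  let rep : (Z → ℝ) → I := fun c =>
    if h : ∃ i, ∀ j, |v i (w j) - c (w j)| ≤ N * ε then h.choose else i₀
  refine ⟨C.image rep, le_trans (by exact_mod_cast Finset.card_image_le) hC, fun i => ?_⟩
  obtain ⟨c, hc, hic⟩ := hcov (v i) (hv i)
  have h1 := hpt _ _ hic
  have hex : ∃ i, ∀ j, |v i (w j) - c (w j)| ≤ N * ε := ⟨i, h1⟩
  have h2 : ∀ j, |v (rep c) (w j) - c (w j)| ≤ N * ε := by
    simp only [rep, dif_pos hex]
    exact hex.choose_spec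
  refine ⟨rep c, Finset.mem_image_of_mem _ hc, fun j => ?_⟩
  have := abs_sub_le (v i (w j)) (c (w j)) (v (rep c) (w j))
  rw [abs_sub_comm (c (w j))] at this
  linarith [h1 j, h2 j]

/-- A class that contains the multiples `s • f`, `|s| ≤ 1`, and has a finite uniform covering
number is bounded on the sample space. -/
theorem CoverBound.abs_le {D : Set Z} (hD : MeasurableSet D) {F : Set (Z → ℝ)} {A V : ℝ}
    (hA : 0 ≤ A) (hF : CoverBound D F A V) {f : Z → ℝ}
    (hf : ∀ s ∈ Set.Icc (0 : ℝ) 1, (fun z => s * f z) ∈ F) {z : Z} (hz : z ∈ D) :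
    |f z| ≤ A * (1 / 2 : ℝ) ^ (-V) + 1 := by
  have hr : 0 ≤ A * (1 / 2 : ℝ) ^ (-V) := by positivity
  obtain ⟨C, hC, hcov⟩ := exists_finset_of_coveringNumberL1_le hr
    (hF (Measure.dirac z) inferInstance (by simp [Measure.dirac_apply' _ hD.compl, hz]) (1 / 2)
      (by norm_num) (by norm_num))
  by_contra hcon
  push Not at hcon
  set M := C.card with hM
  -- Pigeonhole under a point mass: `M + 1` equally spaced multiples of `f z` are covered by `M`
  -- balls of radius `1 / 2`, so two multiples lie within distance 1 and `|f z| ≤ M + 1`.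
  have hs : ∀ k : Fin (M + 1), ∃ c ∈ C, |(k : ℝ) / (M + 1) * f z - c z| ≤ 1 / 2 := by
    intro k
    have hk : (k : ℝ) / (M + 1) ∈ Set.Icc (0 : ℝ) 1 := by
      refine ⟨by positivity, (div_le_one (by positivity)).2 ?_⟩
      exact_mod_cast k.2.le
    obtain ⟨c, hc, h⟩ := hcov _ (hf _ hk)
    rw [lintegral_dirac, Real.enorm_eq_ofReal_abs] at h
    exact ⟨c, hc, (ENNReal.ofReal_le_ofReal_iff (by norm_num)).1 h⟩
  choose c hcC hc using hs
  obtain ⟨k, -, l, -, hkl, heq⟩ := Finset.exists_ne_map_eq_of_card_lt_of_maps_to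
    (s := (Finset.univ : Finset (Fin (M + 1)))) (t := C) (by simp [hM]) (fun k _ => hcC k)
  have h1 := hc k
  have h2 := hc l
  rw [← heq, abs_sub_comm] at h2
  have h3 := (abs_sub_le _ _ _).trans (add_le_add h1 h2)
  rw [← sub_mul, ← sub_div, abs_mul, abs_div, abs_of_pos (by positivity : (0 : ℝ) < M + 1)] at h3
  have h4 : (1 : ℝ) ≤ |(k : ℝ) - l| := by
    have : (k : ℤ) - l ≠ 0 := by
      rw [sub_ne_zero]
      exact_mod_cast fun h => hkl (Fin.ext h)
    exact_mod_cast Int.one_le_abs this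
  rw [div_mul_eq_mul_div, div_le_iff₀ (by positivity)] at h3
  nlinarith [abs_nonneg (f z)]

end Nets

/-- The square truncated at level `b`. -/
def truncSq (b x : ℝ) : ℝ := min |x| b ^ 2

theorem truncSq_nonneg (b x : ℝ) : 0 ≤ truncSq b x := sq_nonneg _

theorem truncSq_le_sq {b : ℝ} (hb : 0 ≤ b) (x : ℝ) : truncSq b x ≤ x ^ 2 := by
  rw [← sq_abs x]
  exact pow_le_pow_left₀ (le_min (abs_nonneg _) hb) (min_le_left _ _) 2

theorem truncSq_le {b : ℝ} (hb : 0 ≤ b) (x : ℝ) : truncSq b x ≤ b ^ 2 :=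
  pow_le_pow_left₀ (le_min (abs_nonneg _) hb) (min_le_right _ _) 2

theorem truncSq_eq {b x : ℝ} (hx : |x| ≤ b) : truncSq b x = x ^ 2 := by
  rw [truncSq, min_eq_left hx, sq_abs]

theorem abs_truncSq_sub_le {b : ℝ} (hb : 0 ≤ b) (x y : ℝ) :
    |truncSq b x - truncSq b y| ≤ 2 * b * |x - y| := by
  have h1 : |min |x| b - min |y| b| ≤ |x - y| :=
    (abs_min_sub_min_le_max |x| b |y| b).trans (by
      simpa using abs_abs_sub_abs_le_abs_sub x y)
  have h2 : truncSq b x - truncSq b y = (min |x| b + min |y| b) * (min |x| b - min |y| b) := by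
    unfold truncSq; ring
  have h3 : 0 ≤ min |x| b := le_min (abs_nonneg _) hb
  have h4 : 0 ≤ min |y| b := le_min (abs_nonneg _) hb
  rw [h2, abs_mul, abs_of_nonneg (add_nonneg h3 h4)]
  exact mul_le_mul (by linarith [min_le_right |x| b, min_le_right |y| b]) h1 (abs_nonneg _)
    (by positivity)

theorem measurable_truncSq (b : ℝ) : Measurable (truncSq b) := by
  unfold truncSq
  fun_prop

/-- Truncation makes the square Lipschitz and bounded everywhere, so nets of the family pass to its
truncated squares although the moment functions are bounded by `Y` only almost surely, with a null
set depending on the index. -/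
theorem HasNets.truncSq {Z I : Type*} [MeasurableSpace Z] [MeasurableSpace I] {D : Set Z}
    {v : I → Z → ℝ} {N : ℕ} {η κ b : ℝ} (hb : 0 ≤ b) (h : HasNets D v N η κ) :
    HasNets D (fun i z => truncSq b (v i z)) N (2 * b * η) κ := by
  intro w hw
  obtain ⟨J, hJ, hcov⟩ := h w hw
  refine ⟨J, hJ, fun i => ?_⟩
  obtain ⟨k, hk, hik⟩ := hcov i
  exact ⟨k, hk, fun j => (abs_truncSq_sub_le hb _ _).trans
    (mul_le_mul_of_nonneg_left (hik j) (by positivity))⟩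

/-! ### Moment inequalities for sums over an i.i.d. sample -/

section Sums

variable {Z : Type*} [MeasurableSpace Z] (P : Measure Z) [IsProbabilityMeasure P]

theorem integral_sum_pi {n : ℕ} {u : Z → ℝ} (hu : Integrable u P) :
    ∫ z, ∑ j, u (z j) ∂(Measure.pi fun _ : Fin n => P) = n * ∫ z, u z ∂P := by
  rw [integral_finsetSum _ fun j _ => integrable_comp_eval (μ := fun _ : Fin n => P) hu]
  simp [integral_comp_eval (μ := fun _ : Fin n => P) hu.aestronglyMeasurable]

theorem measure_pi_sum_ge_le {n : ℕ} {u : Z → ℝ} (hu : Integrable u P) (h0 : 0 ≤ᵐ[P] u) {t : ℝ}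
    (ht : 0 < t) :
    (Measure.pi fun _ : Fin n => P) {z | t ≤ ∑ j, u (z j)} ≤
      ENNReal.ofReal (n * (∫ z, u z ∂P) / t) := by
  have hint : Integrable (fun z : Fin n → Z => ∑ j, u (z j)) (Measure.pi fun _ : Fin n => P) :=
    integrable_finsetSum _ fun j _ => integrable_comp_eval (μ := fun _ : Fin n => P) hu
  have hnn : 0 ≤ᵐ[Measure.pi fun _ : Fin n => P] fun z : Fin n → Z => ∑ j, u (z j) := by
    have : ∀ᵐ z ∂(Measure.pi fun _ : Fin n => P), ∀ j, 0 ≤ u (z j) := by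
      rw [ae_all_iff]
      exact fun j => (Measure.quasiMeasurePreserving_eval (fun _ => P) j).ae h0
    filter_upwards [this] with z hz
    exact Finset.sum_nonneg fun j _ => hz j
  have h := mul_meas_ge_le_integral_of_nonneg hnn hint t
  rw [integral_sum_pi P hu] at h
  rw [← ENNReal.ofReal_toReal (measure_ne_top (Measure.pi fun _ : Fin n => P) _)]
  refine ENNReal.ofReal_le_ofReal ((le_div_iff₀ ht).2 ?_)
  rw [mul_comm]
  exact h

theorem measure_pi_abs_sum_sub_ge_le {n : ℕ} {u : Z → ℝ} (hu : MemLp u 2 P) {t : ℝ}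
    (ht : 0 < t) :
    (Measure.pi fun _ : Fin n => P) {z | t ≤ |∑ j, u (z j) - n * ∫ z, u z ∂P|} ≤
      ENNReal.ofReal (n * (∫ z, u z ^ 2 ∂P) / t ^ 2) := by
  have hL : MemLp (∑ j, fun z : Fin n → Z => u (z j)) 2 (Measure.pi fun _ : Fin n => P) :=
    memLp_finsetSum' _ fun j _ =>
      hu.comp_measurePreserving (measurePreserving_eval (fun _ : Fin n => P) j)
  have h := meas_ge_le_variance_div_sq hL ht
  rw [variance_sum_pi (μ := fun _ : Fin n => P) (X := fun _ => u) fun _ => hu] at h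
  simp only [Finset.sum_apply, integral_sum_pi P (hu.integrable one_le_two),
    Finset.sum_const, Finset.card_univ, Fintype.card_fin, nsmul_eq_mul] at h
  refine h.trans (ENNReal.ofReal_le_ofReal ?_)
  gcongr
  exact variance_le_expectation_sq hu.aestronglyMeasurable

end Sums

/-! ### Maximal inequalities for one sample -/

/-- The multiple of `log n` at which the exponential bound beats the entropy `n ^ (4 V)`. -/
def rateConst (V : ℝ) : ℝ := 32 * (4 * V + 1)

theorem le_rateConst {V : ℝ} (hV : 0 < V) : 32 ≤ rateConst V := by
  unfold rateConst; linarith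

theorem half_eq_ofReal : (1 / 2 : ℝ≥0∞) = ENNReal.ofReal (1 / 2) := by
  rw [ENNReal.ofReal_div_of_pos (by norm_num)]; simp

section Maximal

variable {Z I : Type*} [MeasurableSpace Z] [StandardBorelSpace Z] [MeasurableSpace I]
  [StandardBorelSpace I] {n : ℕ} (P : Measure Z) [IsProbabilityMeasure P] {D : Set Z}
  {A V : ℝ}

/-- A net at scale `n^{-4}` has at most `A n^{4V}` elements, while `R = rateConst V * log n` makes
the tail `2 n^{-(4V+1)}`. The product is `2 A / n`. -/
theorem measure_exists_selfNormalized_le_div (hD : P Dᶜ = 0) {u : I → Z → ℝ}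
    (hu : Measurable fun p : I × Z => u p.1 p.2) {c : ℝ} (hV : 0 < V)
    (hnet : HasNets D u (n + n) (c / n ^ 3) (A * (((n : ℝ) ^ 4)⁻¹) ^ (-V)))
    (hn1 : 1 ≤ n) (hn2 : 4 * c ≤ n) (hn3 : 4 * rateConst V * c ^ 2 ≤ n) :
    (Measure.pi fun _ : Fin n => P.prod P)
      {w | ∃ i, 1 ≤ |∑ j, (u i (w j).1 - u i (w j).2)| ∧
        rateConst V * Real.log n * ∑ j, (u i (w j).1 - u i (w j).2) ^ 2 ≤
          (∑ j, (u i (w j).1 - u i (w j).2)) ^ 2} ≤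
      ENNReal.ofReal (2 * A / n) := by
  have hρ := le_rateConst hV
  have hn : (1 : ℝ) ≤ n := by exact_mod_cast hn1
  have hn0 : (0 : ℝ) < n := by linarith
  have hL : 0 ≤ Real.log n := Real.log_nonneg hn
  have hLn : Real.log n ≤ n := (Real.log_le_sub_one_of_pos hn0).trans (by linarith)
  refine (measure_exists_selfNormalized_le P hD hu hnet (R := rateConst V * Real.log n)
    (by positivity) ?_ ?_).trans_eq ?_
  · have : (n : ℝ) * (c / n ^ 3) = c / n ^ 2 := by field_simp
    rw [this, div_le_iff₀ (by positivity)]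
    nlinarith
  · have : rateConst V * Real.log n * (n * (c / n ^ 3) ^ 2) =
        (rateConst V * c ^ 2) * Real.log n / n ^ 5 := by field_simp
    rw [this, div_le_iff₀ (by positivity)]
    have h1 : (n : ℝ) ^ 2 ≤ n ^ 5 := pow_le_pow_right₀ hn (by norm_num)
    have h2 : (rateConst V * c ^ 2) * Real.log n ≤ (1 / 4 * n) * n :=
      mul_le_mul (by linarith) hLn hL (by positivity)
    nlinarith
  · congr 1
    have e1 : (((n : ℝ) ^ 4)⁻¹) ^ (-V) = Real.exp (4 * V * Real.log n) := by
      rw [Real.rpow_neg (by positivity), Real.inv_rpow (by positivity), inv_inv,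
        Real.rpow_def_of_pos (by positivity), Real.log_pow]
      congr 1; push_cast; ring
    have e2 : Real.exp (-(rateConst V * Real.log n / 32)) =
        Real.exp (-(4 * V * Real.log n)) * (n : ℝ)⁻¹ := by
      conv_rhs => rw [← Real.exp_log (inv_pos.2 hn0), ← Real.exp_add, Real.log_inv]
      congr 1
      unfold rateConst; ring
    rw [e1, e2, Real.exp_neg]
    field_simp

variable {B₀ c : ℝ} {u : I → Z → ℝ}

/-- Population means of bounded nonnegative functions are controlled by sample means. -/
theorem measure_exists_mean_gt_le (hD : P Dᶜ = 0)
    (hu : Measurable fun p : I × Z => u p.1 p.2) (hu0 : ∀ i z, 0 ≤ u i z)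
    (huB : ∀ i z, u i z ≤ B₀) (hB : 1 ≤ B₀) (hV : 0 < V)
    (hnet : HasNets D u (n + n) (c / n ^ 3) (A * (((n : ℝ) ^ 4)⁻¹) ^ (-V)))
    (hn1 : 1 ≤ n) (hL : 1 ≤ Real.log n) (hn2 : 4 * c ≤ n) (hn3 : 4 * rateConst V * c ^ 2 ≤ n) :
    (Measure.pi fun _ : Fin n => P) {z | ∃ i,
      4 * ∑ j, u i (z j) + 12 * B₀ * rateConst V * Real.log n < n * ∫ x, u i x ∂P} ≤
      2 * ENNReal.ofReal (2 * A / n) := by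
  have hρ := le_rateConst hV
  have hui : ∀ i, Measurable (u i) := fun i => hu.comp measurable_prodMk_left
  have hb : ∀ i, ∀ᵐ z ∂P, ‖u i z‖ ≤ B₀ := fun i => ae_of_all _ fun z => by
    rw [Real.norm_eq_abs, abs_of_nonneg (hu0 i z)]; exact huB i z
  have hLp : ∀ i, MemLp (u i) 2 P := fun i =>
    MemLp.of_bound (hui i).aestronglyMeasurable B₀ (hb i)
  have hCL : 12 * B₀ * 32 * 1 ≤ 12 * B₀ * rateConst V * Real.log n := by gcongr
  refine (measure_exists_le_two_mul P
    (fun i z => 4 * ∑ j, u i (z j) + 12 * B₀ * rateConst V * Real.log n < n * ∫ x, u i x ∂P)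
    (fun i z => n * (∫ x, u i x ∂P) / 2 < ∑ j, u i (z j)) ?_ ?_).trans
    (mul_le_mul_right (measure_exists_selfNormalized_le_div P hD hu hV hnet hn1 hn2 hn3) _)
  -- Chebyshev: the variance of the sum is at most `B₀ m`, and `m > 12 · 32 · B₀` makes `4 B₀ / m`
  -- less than `1 / 2`.
  · intro i z hz
    have hU : 0 ≤ ∑ j, u i (z j) := Finset.sum_nonneg fun j _ => hu0 i _
    set m := n * ∫ x, u i x ∂P with hm
    have hm0 : 0 < m := by linarith
    have h := measure_pi_abs_sum_sub_ge_le P (n := n) (hLp i) (half_pos hm0)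
    refine (measure_mono fun z' (hz' : ¬ _) => ?_).trans (h.trans ?_)
    · change m / 2 ≤ |∑ j, u i (z' j) - m|
      rw [abs_sub_comm]
      exact le_trans (by linarith [not_lt.1 hz']) (le_abs_self _)
    · have h1 : ∫ x, u i x ^ 2 ∂P ≤ B₀ * ∫ x, u i x ∂P := by
        rw [← integral_const_mul]
        refine integral_mono (hLp i).integrable_sq
          (((hLp i).integrable one_le_two).const_mul _) fun x => ?_
        change u i x ^ 2 ≤ B₀ * u i x
        rw [sq]
        exact mul_le_mul_of_nonneg_right (huB i x) (hu0 i x)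
      have h2 : n * (∫ x, u i x ^ 2 ∂P) ≤ B₀ * m := by
        rw [hm, mul_left_comm]
        exact mul_le_mul_of_nonneg_left h1 (Nat.cast_nonneg _)
      rw [half_eq_ofReal]
      refine ENNReal.ofReal_le_ofReal ((div_le_iff₀ (by positivity)).2 ?_)
      nlinarith
  -- Here `U < m / 4 < U' / 2`, so the difference exceeds `U' / 2` and the squared increments sum to
  -- at most `(3 / 2) B₀ U'`. It remains that `U' ≥ 6 B₀ ρ log n`, which is where the 12 in the
  -- statement comes from.
  · intro w i hM hN
    refine ⟨i, ?_⟩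
    set m := n * ∫ x, u i x ∂P with hm
    set U := ∑ j, u i (w j).1 with hU
    set U' := ∑ j, u i (w j).2 with hU'
    have hU0 : 0 ≤ U := Finset.sum_nonneg fun j _ => hu0 i _
    have hM' : 4 * U + 12 * B₀ * rateConst V * Real.log n < m := hM
    have hN' : m / 2 < U' := hN
    have hq : ∑ j, (u i (w j).1 - u i (w j).2) ^ 2 ≤ B₀ * (U + U') := by
      rw [hU, hU', ← Finset.sum_add_distrib, Finset.mul_sum]
      refine Finset.sum_le_sum fun j _ => ?_
      nlinarith [hu0 i (w j).1, hu0 i (w j).2, huB i (w j).1, huB i (w j).2,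
        mul_nonneg (hu0 i (w j).1) (hu0 i (w j).2)]
    rw [Finset.sum_sub_distrib, ← hU, ← hU']
    refine ⟨?_, ?_⟩
    · rw [abs_sub_comm]
      exact le_trans (by linarith) (le_abs_self _)
    · have h1 : rateConst V * Real.log n * ∑ j, (u i (w j).1 - u i (w j).2) ^ 2 ≤
          rateConst V * Real.log n * (B₀ * (U + U')) :=
        mul_le_mul_of_nonneg_left hq (by positivity)
      have h2 : 12 * (B₀ * rateConst V * Real.log n) ≤ 2 * U' := by linarith
      have h3 : U ≤ U' / 2 := by linarith
      nlinarith

/-- Sample means of bounded nonnegative functions are controlled by population means. -/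
theorem measure_exists_sum_gt_le (hD : P Dᶜ = 0)
    (hu : Measurable fun p : I × Z => u p.1 p.2) (hu0 : ∀ i z, 0 ≤ u i z)
    (huB : ∀ i z, u i z ≤ B₀) (hB : 1 ≤ B₀) (hV : 0 < V)
    (hnet : HasNets D u (n + n) (c / n ^ 3) (A * (((n : ℝ) ^ 4)⁻¹) ^ (-V)))
    (hn1 : 1 ≤ n) (hL : 1 ≤ Real.log n) (hn2 : 4 * c ≤ n) (hn3 : 4 * rateConst V * c ^ 2 ≤ n) :
    (Measure.pi fun _ : Fin n => P) {z | ∃ i,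
      12 * B₀ * rateConst V * (n * (∫ x, u i x ∂P) + Real.log n) < ∑ j, u i (z j)} ≤
      2 * ENNReal.ofReal (2 * A / n) := by
  have hρ := le_rateConst hV
  have hui : ∀ i, Measurable (u i) := fun i => hu.comp measurable_prodMk_left
  have hb : ∀ i, ∀ᵐ z ∂P, ‖u i z‖ ≤ B₀ := fun i => ae_of_all _ fun z => by
    rw [Real.norm_eq_abs, abs_of_nonneg (hu0 i z)]; exact huB i z
  have hint : ∀ i, Integrable (u i) P := fun i =>
    Integrable.of_bound (hui i).aestronglyMeasurable B₀ (hb i)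
  have hC : 12 * 1 * 32 ≤ 12 * B₀ * rateConst V := by gcongr
  have hm0 : ∀ i, 0 ≤ n * ∫ x, u i x ∂P := fun i =>
    mul_nonneg (Nat.cast_nonneg _) (integral_nonneg (hu0 i))
  refine (measure_exists_le_two_mul P
    (fun i z => 12 * B₀ * rateConst V * (n * (∫ x, u i x ∂P) + Real.log n) < ∑ j, u i (z j))
    (fun i z => ∑ j, u i (z j) < 2 * (n * (∫ x, u i x ∂P) + Real.log n)) ?_ ?_).trans
    (mul_le_mul_right (measure_exists_selfNormalized_le_div P hD hu hV hnet hn1 hn2 hn3) _)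
  -- Markov's inequality suffices here, since only an upper bound on the second sample is needed.
  · intro i z _
    have hm := hm0 i
    have h := measure_pi_sum_ge_le P (n := n) (hint i) (ae_of_all _ (hu0 i))
      (t := 2 * (n * (∫ x, u i x ∂P) + Real.log n)) (by linarith)
    refine (measure_mono fun z' (hz' : ¬ _) => not_lt.1 hz').trans (h.trans ?_)
    rw [half_eq_ofReal]
    refine ENNReal.ofReal_le_ofReal ((div_le_iff₀ (by linarith)).2 ?_)
    linarith
  · intro w i hM hN
    refine ⟨i, ?_⟩
    have hm := hm0 i
    set m := n * ∫ x, u i x ∂P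
    set U := ∑ j, u i (w j).1 with hU
    set U' := ∑ j, u i (w j).2 with hU'
    have hU'0 : 0 ≤ U' := Finset.sum_nonneg fun j _ => hu0 i _
    have hM' : 12 * B₀ * rateConst V * (m + Real.log n) < U := hM
    have hN' : U' < 2 * (m + Real.log n) := hN
    have hq : ∑ j, (u i (w j).1 - u i (w j).2) ^ 2 ≤ B₀ * (U + U') := by
      rw [hU, hU', ← Finset.sum_add_distrib, Finset.mul_sum]
      refine Finset.sum_le_sum fun j _ => ?_
      nlinarith [hu0 i (w j).1, hu0 i (w j).2, huB i (w j).1, huB i (w j).2,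
        mul_nonneg (hu0 i (w j).1) (hu0 i (w j).2)]
    have h4 : 4 * (m + Real.log n) < U :=
      lt_of_le_of_lt (mul_le_mul_of_nonneg_right (by linarith) (by linarith)) hM'
    have h5 : 12 * B₀ * rateConst V * Real.log n < U :=
      lt_of_le_of_lt (mul_le_mul_of_nonneg_left (by linarith) (by linarith)) hM'
    rw [Finset.sum_sub_distrib, ← hU, ← hU']
    refine ⟨le_trans (by linarith) (le_abs_self _), ?_⟩
    have h1 : rateConst V * Real.log n * ∑ j, (u i (w j).1 - u i (w j).2) ^ 2 ≤
        rateConst V * Real.log n * (B₀ * (U + U')) :=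
      mul_le_mul_of_nonneg_left hq (by positivity)
    have h3 : U' ≤ U / 2 := by linarith
    nlinarith

/-- The self-normalized maximal inequality for one sample, for mean zero functions whose population
second moment is controlled by the sample second moment. -/
theorem measure_exists_selfNormalized_one_sample_le (hD : P Dᶜ = 0)
    (hu : Measurable fun p : I × Z => u p.1 p.2) (hLp : ∀ i, MemLp (u i) 2 P)
    (hmean : ∀ i, ∫ x, u i x ∂P = 0) {C : ℝ} (hC : 0 ≤ C) (hV : 0 < V)
    (hnet : HasNets D u (n + n) (c / n ^ 3) (A * (((n : ℝ) ^ 4)⁻¹) ^ (-V)))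
    (hn1 : 1 ≤ n) (hL : 1 ≤ Real.log n) (hn2 : 4 * c ≤ n) (hn3 : 4 * rateConst V * c ^ 2 ≤ n) :
    (Measure.pi fun _ : Fin n => P) {z | ∃ i,
      n * (∫ x, u i x ^ 2 ∂P) ≤ 4 * ∑ j, u i (z j) ^ 2 + C * Real.log n ∧
      272 * rateConst V * Real.log n * ∑ j, u i (z j) ^ 2 ≤ (∑ j, u i (z j)) ^ 2 ∧
      64 * rateConst V * (C + 1) * Real.log n ^ 2 ≤ (∑ j, u i (z j)) ^ 2} ≤
      2 * ENNReal.ofReal (2 * A / n) := by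
  have hρ := le_rateConst hV
  have hv0 : ∀ i, 0 ≤ n * ∫ x, u i x ^ 2 ∂P := fun i =>
    mul_nonneg (Nat.cast_nonneg _) (integral_nonneg fun x => sq_nonneg _)
  have hquarter : (1 / 2 : ℝ≥0∞) = ENNReal.ofReal (1 / 4) + ENNReal.ofReal (1 / 4) := by
    rw [← ENNReal.ofReal_add (by norm_num) (by norm_num), half_eq_ofReal]
    norm_num
  refine (measure_exists_le_two_mul P
    (fun i z => n * (∫ x, u i x ^ 2 ∂P) ≤ 4 * ∑ j, u i (z j) ^ 2 + C * Real.log n ∧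
      272 * rateConst V * Real.log n * ∑ j, u i (z j) ^ 2 ≤ (∑ j, u i (z j)) ^ 2 ∧
      64 * rateConst V * (C + 1) * Real.log n ^ 2 ≤ (∑ j, u i (z j)) ^ 2)
    (fun i z => |∑ j, u i (z j)| < 2 * √(n * (∫ x, u i x ^ 2 ∂P) + 1) ∧
      ∑ j, u i (z j) ^ 2 < 4 * (n * (∫ x, u i x ^ 2 ∂P) + 1)) ?_ ?_).trans
    (mul_le_mul_right (measure_exists_selfNormalized_le_div P hD hu hV hnet hn1 hn2 hn3) _)
  -- Chebyshev for the sum and Markov for the sum of squares each fail with probability at most `1 /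
  -- 4`. The `+ 1` keeps the thresholds positive when `v = 0`.
  · intro i z _
    have hv := hv0 i
    set v := n * ∫ x, u i x ^ 2 ∂P with hvd
    have h1 := measure_pi_abs_sum_sub_ge_le P (n := n) (hLp i)
      (t := 2 * √(v + 1)) (by positivity)
    have h2 := measure_pi_sum_ge_le P (n := n) (hLp i).integrable_sq
      (ae_of_all _ fun x => sq_nonneg _) (t := 4 * (v + 1)) (by positivity)
    rw [hquarter]
    refine (measure_mono (t := {z : Fin n → Z | 2 * √(v + 1) ≤ |∑ j, u i (z j)
        - n * ∫ x, u i x ∂P|} ∪ {z | 4 * (v + 1) ≤ ∑ j, u i (z j) ^ 2})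
        fun z' (hz' : ¬ _) => ?_).trans
      ((measure_union_le _ _).trans (add_le_add (h1.trans ?_) (h2.trans ?_)))
    · rw [not_and_or, not_lt, not_lt] at hz'
      simpa [hmean i] using hz'
    · refine ENNReal.ofReal_le_ofReal ((div_le_iff₀ (by positivity)).2 ?_)
      rw [← hvd, mul_pow, Real.sq_sqrt (by positivity)]
      linarith
    · refine ENNReal.ofReal_le_ofReal ((div_le_iff₀ (by positivity)).2 ?_)
      rw [← hvd]
      linarith
  · rintro w i ⟨hM1, hM2, hM3⟩ ⟨hN1, hN2⟩
    refine ⟨i, ?_⟩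
    have hv := hv0 i
    set v := n * ∫ x, u i x ^ 2 ∂P with hvd
    set L := Real.log n
    set ρ := rateConst V
    set S := ∑ j, u i (w j).1 with hS
    set S' := ∑ j, u i (w j).2 with hS'
    set Q := ∑ j, u i (w j).1 ^ 2 with hQ
    set Q' := ∑ j, u i (w j).2 ^ 2 with hQ'
    have hQ0 : 0 ≤ Q := Finset.sum_nonneg fun j _ => sq_nonneg _
    have hq : ∑ j, (u i (w j).1 - u i (w j).2) ^ 2 ≤ 2 * (Q + Q') := by
      rw [hQ, hQ', ← Finset.sum_add_distrib, Finset.mul_sum]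
      refine Finset.sum_le_sum fun j _ => ?_
      nlinarith [sq_nonneg (u i (w j).1 + u i (w j).2)]
    rw [Finset.sum_sub_distrib, ← hS, ← hS']
    have hv1 : v + 1 ≤ 4 * Q + (C + 1) * L := by linarith
    have hρL : 32 * 1 ≤ ρ * L := mul_le_mul hρ hL zero_le_one (by linarith)
    have hQS : 272 * 32 * Q ≤ S ^ 2 := by nlinarith
    have hLS : 64 * 32 * ((C + 1) * L) ≤ S ^ 2 := by
      have : 32 * ((C + 1) * L) ≤ ρ * L * ((C + 1) * L) :=
        mul_le_mul_of_nonneg_right (by linarith) (by positivity)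
      nlinarith
    have hvS : 16 * (v + 1) ≤ S ^ 2 := by linarith
    have hsq : 2 * √(v + 1) ≤ |S| / 2 := by
      have : √(v + 1) ≤ |S| / 4 := by
        rw [Real.sqrt_le_left (by positivity), div_pow, sq_abs]
        linarith
      linarith
    have hdiff : |S| / 2 ≤ |S - S'| := by
      have h1 : |S'| < 2 * √(v + 1) := hN1
      have := abs_sub_abs_le_abs_sub S S'
      linarith
    have hS2 : S ^ 2 / 4 ≤ (S - S') ^ 2 := by
      rw [← sq_abs S, ← sq_abs (S - S')]
      nlinarith [abs_nonneg S]
    refine ⟨?_, ?_⟩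
    · refine le_trans ?_ hdiff
      have : 2 ≤ |S| := by
        rw [← abs_of_pos (zero_lt_two' ℝ)]
        refine sq_le_sq.1 ?_
        nlinarith
      linarith
    · have hN2' : Q' < 4 * (v + 1) := hN2
      -- `2 Q + 2 Q'` with `Q' < 4 (v + 1)` and `v + 1 ≤ 4 Q + (C + 1) L`. The constants `272 = 8 ·
      -- 34` and `64 = 8 · 8` make each part, times `ρ L`, at most `S² / 8`, to be compared with `S²
      -- / 4 ≤ (S - S')²`.
      have h1 : ∑ j, (u i (w j).1 - u i (w j).2) ^ 2 ≤ 34 * Q + 8 * ((C + 1) * L) := by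
        linarith
      have h2 := mul_le_mul_of_nonneg_left h1 (by linarith : 0 ≤ ρ * L)
      have h3 : ρ * L * (34 * Q + 8 * ((C + 1) * L)) =
        (272 * ρ * L * Q) / 8 + (64 * ρ * (C + 1) * L ^ 2) / 8 := by ring
      linarith

end Maximal

/-! ### The uniform control of centred sample moments -/

/-- The constant in the lower bound of the sample second moments. -/
noncomputable def varConst (Y V : ℝ) : ℝ := 12 * (2 * Y) ^ 2 * rateConst V

/-- The uniform bound on the moment functions over the sample space. -/
noncomputable def envConst (A V : ℝ) : ℝ := A * (1 / 2 : ℝ) ^ (-V) + 1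

/-- The constant in the upper bound of the sample second moments. -/
noncomputable def sampleVarConst (Y A V : ℝ) : ℝ := 12 * (envConst A V + Y) ^ 2 * rateConst V

/-- The sample `z` controls the centred function `h` at the self-normalized rate. -/
def GoodSample {Z : Type*} [MeasurableSpace Z] (P : Measure Z) (Y A V : ℝ) {n : ℕ} (z : Fin n → Z)
    (h : Z → ℝ) : Prop :=
  n * (∫ x, h x ^ 2 ∂P) ≤ 4 * ∑ j, h (z j) ^ 2 + varConst Y V * Real.log n ∧
  ∑ j, h (z j) ^ 2 ≤ sampleVarConst Y A V * (n * (∫ x, h x ^ 2 ∂P) + Real.log n) ∧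
  ((∑ j, h (z j)) ^ 2 < 272 * rateConst V * Real.log n * ∑ j, h (z j) ^ 2 ∨
    (∑ j, h (z j)) ^ 2 < 64 * rateConst V * (varConst Y V + 1) * Real.log n ^ 2)

theorem eventually_le_natCast (r : ℝ) : ∀ᶠ n : ℕ in atTop, r ≤ n :=
  tendsto_natCast_atTop_atTop.eventually_ge_atTop r

theorem eventually_le_log (r : ℝ) : ∀ᶠ n : ℕ in atTop, r ≤ Real.log n :=
  (Real.tendsto_log_atTop.comp tendsto_natCast_atTop_atTop).eventually_ge_atTop r

/-- The centred family is uniformly controlled by the sample with probability approaching one, at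
a rate that does not depend on the distribution. -/
theorem eventually_measure_not_goodSample_le {Z I : Type*} [MeasurableSpace Z]
    [StandardBorelSpace Z] [MeasurableSpace I] [StandardBorelSpace I]
    {D : Set Z} (hDm : MeasurableSet D) {F : Set (Z → ℝ)} {Y A V : ℝ} (hY : 1 ≤ Y) (hA : 0 ≤ A)
    (hV : 0 < V) (hF : CoverBound D F A V) {f : I → Z → ℝ}
    (hf : Measurable fun p : I × Z => f p.1 p.2)
    (hmem : ∀ i, ∀ s ∈ Set.Icc (-Y) Y, ∀ t ∈ Set.Icc (-Y) Y, (fun z => s * f i z + t) ∈ F) :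
    ∀ᶠ n : ℕ in atTop, ∀ P : Measure Z, IsProbabilityMeasure P → P Dᶜ = 0 →
      (∀ i, ∀ᵐ z ∂P, |f i z| ≤ Y) →
      (Measure.pi fun _ : Fin n => P)
        {z | ∃ i, ¬ GoodSample P Y A V z (fun x => f i x - ∫ y, f i y ∂P)} ≤
      ENNReal.ofReal (12 * A / n) := by
  set b := envConst A V + Y with hb
  have henv : 1 ≤ envConst A V := by
    have : 0 ≤ A * (1 / 2 : ℝ) ^ (-V) := by positivity
    unfold envConst; linarith
  filter_upwards [eventually_ge_atTop 2, eventually_le_log 1, eventually_le_natCast (4 * 4),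
    eventually_le_natCast (4 * rateConst V * 4 ^ 2),
    eventually_le_natCast (4 * (2 * (2 * Y) * 4)),
    eventually_le_natCast (4 * rateConst V * (2 * (2 * Y) * 4) ^ 2),
    eventually_le_natCast (4 * (2 * b * 4)),
    eventually_le_natCast (4 * rateConst V * (2 * b * 4) ^ 2)]
    with n hn hL c1 c2 c3 c4 c5 c6
  intro P hP hD hbd
  have hn1 : 1 ≤ n := by omega
  have hnr : (2 : ℝ) ≤ n := by exact_mod_cast hn
  have hfi : ∀ i, Measurable (f i) := fun i => hf.comp measurable_prodMk_left
  let μ : I → ℝ := fun i => ∫ y, f i y ∂P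
  have hμm : Measurable μ := (hf.stronglyMeasurable.integral_prod_right (ν := P)).measurable
  have hμ : ∀ i, |μ i| ≤ Y := by
    intro i
    have := norm_integral_le_of_norm_le_const (μ := P) (f := f i) (hbd i)
    simpa using this
  let h : I → Z → ℝ := fun i x => f i x - μ i
  have hh : Measurable fun p : I × Z => h p.1 p.2 := hf.sub (hμm.comp measurable_fst)
  have hhi : ∀ i, Measurable (h i) := fun i => (hfi i).sub_const _
  have hfint : ∀ i, Integrable (f i) P := fun i =>
    Integrable.of_bound (hfi i).aestronglyMeasurable Y (hbd i)
  have hh2 : ∀ i, ∀ᵐ z ∂P, |h i z| ≤ 2 * Y := by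
    intro i
    filter_upwards [hbd i] with z hz
    exact (abs_sub _ _).trans (by linarith [hμ i])
  have hLp : ∀ i, MemLp (h i) 2 P := fun i =>
    MemLp.of_bound (hhi i).aestronglyMeasurable (2 * Y) (hh2 i)
  have hmean : ∀ i, ∫ x, h i x ∂P = 0 := fun i => by
    simp only [h]
    rw [integral_sub (hfint i) (integrable_const _)]
    simp [μ]
  -- The shifts `t` in the class are what lets it contain the centred functions.
  have hhF : ∀ i, h i ∈ F := fun i => by
    convert hmem i 1 ⟨by linarith, hY⟩ (-μ i) (by
      have := abs_le.1 (hμ i)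
      exact ⟨by linarith, by linarith⟩) using 1
    ext z
    simp [h, sub_eq_add_neg]
  -- A bound at every point of `D`, hence valid for all indices at once on a sample in `D`.
  have hhD : ∀ i, ∀ z ∈ D, |h i z| ≤ b := by
    intro i z hz
    have h1 : |f i z| ≤ envConst A V := hF.abs_le hDm hA (fun s hs => by
      simpa using hmem i s ⟨by linarith [hs.1], by linarith [hs.2]⟩ 0
        ⟨by linarith, by linarith⟩) hz
    exact (abs_sub _ _).trans (add_le_add h1 (hμ i))
  have hnet : HasNets D h (n + n) (4 / n ^ 3) (A * (((n : ℝ) ^ 4)⁻¹) ^ (-V)) := by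
    have h1 := hF.hasNets hDm hA hhF (N := n + n) (by omega) (ε := ((n : ℝ) ^ 4)⁻¹)
      (by positivity) (inv_lt_one_of_one_lt₀ (one_lt_pow₀ (by linarith) (by norm_num)))
    convert h1 using 1
    push_cast
    field_simp
    ring
  have hnet' : ∀ r : ℝ, 0 ≤ r → HasNets D (fun i z => truncSq r (h i z)) (n + n)
      (2 * r * 4 / n ^ 3) (A * (((n : ℝ) ^ 4)⁻¹) ^ (-V)) := by
    intro r hr
    have := hnet.truncSq hr
    rwa [← mul_div_assoc] at this
  have hsq : ∀ r : ℝ, 1 ≤ r → 1 ≤ r ^ 2 := fun r hr => one_le_pow₀ hr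
  have hvC : 0 ≤ varConst Y V := by
    have := le_rateConst hV
    unfold varConst; positivity
  have htm : ∀ r : ℝ, Measurable fun p : I × Z => truncSq r (h p.1 p.2) := fun r =>
    (measurable_truncSq r).comp hh
  have e1 := measure_exists_selfNormalized_one_sample_le P hD hh hLp hmean hvC hV hnet
    hn1 hL c1 c2
  -- Truncation at `2 Y` leaves the population second moment unchanged and can only lower the sample
  -- one. The resulting constant `varConst` is free of `A`, as `K₀` requires.
  have e2 := measure_exists_mean_gt_le P hD (htm (2 * Y)) (fun i z => truncSq_nonneg _ _)
    (fun i z => truncSq_le (by linarith) _) (hsq (2 * Y) (by linarith)) hV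
    (hnet' (2 * Y) (by linarith)) hn1 hL c3 c4
  -- Truncation at `b` leaves the sample squares unchanged on `D` and can only lower the population
  -- moment. Here the constant depends on `A`, which affects only `B`.
  have e3 := measure_exists_sum_gt_le P hD (htm b) (fun i z => truncSq_nonneg _ _)
    (fun i z => truncSq_le (by linarith) _) (hsq b (by linarith)) hV
    (hnet' b (by linarith)) hn1 hL c5 c6
  have e4 : (Measure.pi fun _ : Fin n => P) {z | ¬ ∀ j, z j ∈ D} = 0 := by
    have h1 : ∀ᵐ z ∂P, z ∈ D := hD
    have h2 : ∀ᵐ z ∂(Measure.pi fun _ : Fin n => P), ∀ j, z j ∈ D := by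
      rw [ae_all_iff]
      exact fun j => (Measure.quasiMeasurePreserving_eval (fun _ => P) j).ae h1
    exact h2
  have hi2 : ∀ i, ∫ x, truncSq (2 * Y) (h i x) ∂P = ∫ x, h i x ^ 2 ∂P := fun i =>
    integral_congr_ae (by
      filter_upwards [hh2 i] with x hx
      exact truncSq_eq hx)
  have hib : ∀ i, ∫ x, truncSq b (h i x) ∂P ≤ ∫ x, h i x ^ 2 ∂P := fun i => by
    exact integral_mono_of_nonneg (ae_of_all _ fun x => truncSq_nonneg _ _)
      (hLp i).integrable_sq (ae_of_all _ fun x => truncSq_le_sq (by linarith) _)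
  refine (measure_mono fun z hz => ?_).trans ((measure_union_le _ _).trans
    (add_le_add ((measure_union_le _ _).trans (add_le_add ((measure_union_le _ _).trans
      (add_le_add e1 e2)) e3)) e4.le)) |>.trans_eq ?_
  · by_contra hcon
    simp only [Set.mem_union, not_or] at hcon
    obtain ⟨⟨⟨k1, k2⟩, k3⟩, k4⟩ := hcon
    obtain ⟨i, hi⟩ := hz
    have hzD : ∀ j, z j ∈ D := not_not.1 k4
    refine hi ?_
    have g1 : n * (∫ x, h i x ^ 2 ∂P) ≤ 4 * ∑ j, h i (z j) ^ 2 + varConst Y V * Real.log n := by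
      by_contra hlt
      refine k2 ⟨i, ?_⟩
      rw [hi2]
      refine lt_of_le_of_lt ?_ (not_le.1 hlt)
      unfold varConst
      gcongr with j
      exact truncSq_le_sq (by linarith) _
    refine ⟨g1, ?_, ?_⟩
    · by_contra hlt
      refine k3 ⟨i, ?_⟩
      rw [Finset.sum_congr rfl fun j _ => truncSq_eq (hhD i _ (hzD j))]
      refine lt_of_le_of_lt ?_ (not_le.1 hlt)
      have := le_rateConst hV
      unfold sampleVarConst
      rw [← hb]
      have h5 := mul_le_mul_of_nonneg_left (hib i) (Nat.cast_nonneg (α := ℝ) n)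
      exact mul_le_mul_of_nonneg_left (by linarith) (by positivity)
    · by_contra hlt
      rw [not_or, not_lt, not_lt] at hlt
      exact k1 ⟨i, g1, hlt⟩
  · rw [add_zero, ← ENNReal.ofReal_ofNat, ← ENNReal.ofReal_mul (by norm_num),
      ← ENNReal.ofReal_add (by positivity) (by positivity),
      ← ENNReal.ofReal_add (by positivity) (by positivity)]
    congr 1
    ring

/-! ### Events of uniformly high probability -/

section UniformlyLikely

variable {Z : Type*} [MeasurableSpace Z] {𝔓 : Set (ProbabilityMeasure Z)}

/-- The version of `UniformWPA1` for properties that may depend on the distribution. -/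
def UniformlyLikely (𝔓 : Set (ProbabilityMeasure Z))
    (E : ProbabilityMeasure Z → (n : ℕ) → (Fin n → Z) → Prop) : Prop :=
  Tendsto (fun n : ℕ => ⨆ P ∈ 𝔓,
    (Measure.pi fun _ : Fin n => (P : Measure Z)) {z | ¬ E P n z}) atTop (𝓝 0)

variable {E E' : ProbabilityMeasure Z → (n : ℕ) → (Fin n → Z) → Prop}

theorem UniformlyLikely.of_measure_le {b : ℕ → ℝ≥0∞} (hb : Tendsto b atTop (𝓝 0))
    (h : ∀ᶠ n : ℕ in atTop, ∀ P ∈ 𝔓,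
      (Measure.pi fun _ : Fin n => (P : Measure Z)) {z | ¬ E P n z} ≤ b n) :
    UniformlyLikely 𝔓 E :=
  tendsto_of_tendsto_of_tendsto_of_le_of_le' tendsto_const_nhds hb
    (Eventually.of_forall fun _ => zero_le) (by
      filter_upwards [h] with n hn
      exact iSup₂_le hn)

theorem UniformlyLikely.mono (hE : UniformlyLikely 𝔓 E)
    (h : ∀ᶠ n : ℕ in atTop, ∀ P ∈ 𝔓, ∀ z, E P n z → E' P n z) : UniformlyLikely 𝔓 E' := by
  refine of_measure_le hE ?_
  filter_upwards [h] with n hn P hP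
  refine (measure_mono fun z (hz : ¬ _) => ?_).trans (le_iSup₂ (f := fun P (_ : P ∈ 𝔓) =>
    (Measure.pi fun _ : Fin n => (P : Measure Z)) {z | ¬ E P n z}) P hP)
  exact fun h => hz (hn P hP z h)

theorem UniformlyLikely.and (hE : UniformlyLikely 𝔓 E) (hE' : UniformlyLikely 𝔓 E') :
    UniformlyLikely 𝔓 fun P n z => E P n z ∧ E' P n z := by
  refine of_measure_le (by simpa using Tendsto.add hE hE') (Eventually.of_forall fun n P hP => ?_)
  refine le_trans ?_ (add_le_add
    (le_iSup₂ (f := fun P (_ : P ∈ 𝔓) =>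
      (Measure.pi fun _ : Fin n => (P : Measure Z)) {z | ¬ E P n z}) P hP)
    (le_iSup₂ (f := fun P (_ : P ∈ 𝔓) =>
      (Measure.pi fun _ : Fin n => (P : Measure Z)) {z | ¬ E' P n z}) P hP))
  refine (measure_mono fun z (hz : ¬ _) => ?_).trans (measure_union_le _ _)
  exact not_and_or.1 hz

theorem UniformlyLikely.of_uniformWPA1 {E : (n : ℕ) → (Fin n → Z) → Prop}
    (h : UniformWPA1 𝔓 E) : UniformlyLikely 𝔓 fun _ => E := h

end UniformlyLikely

/-! ### Sample and population moments -/

section Moments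

variable {Z : Type*} {n : ℕ} (z : Fin n → Z) (f : Z → ℝ) (m : ℝ)

theorem sampleMean_sub_const (hn : 0 < n) :
    sampleMean z f - m = (∑ j, (f (z j) - m)) / n := by
  have : (n : ℝ) ≠ 0 := by exact_mod_cast hn.ne'
  unfold sampleMean
  rw [Finset.sum_sub_distrib]
  simp
  field_simp

/-- The sample variance is shift invariant, so it can be computed around the population mean;
Cauchy–Schwarz shows that the square root is not cut off at zero. -/
theorem sampleSd_sq (hn : 0 < n) :
    sampleSd z f ^ 2 = (∑ j, (f (z j) - m) ^ 2) / n - ((∑ j, (f (z j) - m)) / n) ^ 2 := by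
  have hn' : (0 : ℝ) < n := by exact_mod_cast hn
  have hid : sampleMean z (fun x => f x ^ 2) - sampleMean z f ^ 2 =
      (∑ j, (f (z j) - m) ^ 2) / n - ((∑ j, (f (z j) - m)) / n) ^ 2 := by
    unfold sampleMean
    simp only [sub_sq, Finset.sum_sub_distrib, Finset.sum_add_distrib, ← Finset.sum_mul,
      ← Finset.mul_sum, Finset.sum_const, Finset.card_univ, Fintype.card_fin, nsmul_eq_mul]
    field_simp
    ring
  have hnn : 0 ≤ (∑ j, (f (z j) - m) ^ 2) / n - ((∑ j, (f (z j) - m)) / n) ^ 2 := by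
    have h := sq_sum_le_card_mul_sum_sq (s := Finset.univ) (f := fun j => f (z j) - m)
    simp only [Finset.card_univ, Fintype.card_fin] at h
    rw [div_pow, sub_nonneg, div_le_div_iff₀ (by positivity) hn']
    nlinarith
  rw [sampleSd, hid, Real.sq_sqrt hnn]

theorem popSd_sq [MeasurableSpace Z] (P : Measure Z) [IsProbabilityMeasure P] {f : Z → ℝ}
    (hf : MemLp f 2 P) : popSd P f ^ 2 = ∫ x, (f x - ∫ y, f y ∂P) ^ 2 ∂P := by
  have hv := variance_eq_sub hf
  rw [variance_eq_integral hf.aestronglyMeasurable.aemeasurable] at hv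
  have hnn : 0 ≤ ∫ x, (f x - ∫ y, f y ∂P) ^ 2 ∂P := integral_nonneg fun _ => sq_nonneg _
  have : (∫ z, f z ^ 2 ∂P) - (∫ z, f z ∂P) ^ 2 = ∫ x, (f x - ∫ y, f y ∂P) ^ 2 ∂P := by
    rw [hv]; rfl
  rw [popSd, this, Real.sq_sqrt hnn]

end Moments

/-- The rate `√(log n / n)`. -/
noncomputable def logRate (n : ℕ) : ℝ := √(Real.log n / n)

theorem logRate_pos {n : ℕ} (hn : 2 ≤ n) : 0 < logRate n := by
  have h : (1 : ℝ) < n := by exact_mod_cast hn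
  exact Real.sqrt_pos.2 (div_pos (Real.log_pos h) (by linarith))

theorem logRate_sq {n : ℕ} (hn : 1 ≤ n) : logRate n ^ 2 = Real.log n / n :=
  Real.sq_sqrt (div_nonneg (Real.log_nonneg (by exact_mod_cast hn)) (Nat.cast_nonneg _))

theorem tendsto_logRate : Tendsto logRate atTop (𝓝 0) := by
  have h : Tendsto (fun n : ℕ => Real.log n / n) atTop (𝓝 0) :=
    (Real.isLittleO_log_id_atTop.tendsto_div_nhds_zero).comp tendsto_natCast_atTop_atTop
  have := (Real.continuous_sqrt.tendsto 0).comp h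
  rwa [Real.sqrt_zero] at this

theorem eventually_logRate_le {r : ℝ} (hr : 0 < r) : ∀ᶠ n : ℕ in atTop, logRate n ≤ r :=
  (tendsto_logRate.eventually_lt_const hr).mono fun _ h => h.le

theorem sqrt_div_log {n : ℕ} : √((n : ℝ) / Real.log n) = (logRate n)⁻¹ := by
  rw [logRate, ← Real.sqrt_inv, inv_div]

/-! ### Deterministic consequences of a good sample. -/

section GoodSample

variable {Z : Type*} [MeasurableSpace Z] {P : Measure Z} [IsProbabilityMeasure P] {Y A V : ℝ}
  {n : ℕ} {z : Fin n → Z} {f : Z → ℝ}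

/-- The bounds that the sample standard deviation and the deviation of the sample mean satisfy on a
good sample. -/
theorem GoodSample.bounds (hn : 2 ≤ n) (hf : MemLp f 2 P)
    (h : GoodSample P Y A V z (fun x => f x - ∫ y, f y ∂P)) :
    sampleSd z f ^ 2 + (sampleMean z f - popMean P f) ^ 2 ≤
      sampleVarConst Y A V * (popSd P f ^ 2 + logRate n ^ 2) ∧
    ((sampleMean z f - popMean P f) ^ 2 < 272 * rateConst V * logRate n ^ 2 *
        (sampleSd z f ^ 2 + (sampleMean z f - popMean P f) ^ 2) ∨
      (sampleMean z f - popMean P f) ^ 2 <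
        64 * rateConst V * (varConst Y V + 1) * (logRate n ^ 2) ^ 2) := by
  have hn0 : 0 < n := by omega
  have hn' : (0 : ℝ) < n := by exact_mod_cast hn0
  obtain ⟨-, h2, h3⟩ := h
  rw [← popSd_sq P hf] at h2
  rw [sampleSd_sq z f (popMean P f) hn0, sampleMean_sub_const z f (popMean P f) hn0,
    logRate_sq (by omega), sub_add_cancel]
  change ∑ j, (f (z j) - popMean P f) ^ 2 ≤ _ at h2
  change (∑ j, (f (z j) - popMean P f)) ^ 2 < _ * ∑ j, (f (z j) - popMean P f) ^ 2 ∨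
    (∑ j, (f (z j) - popMean P f)) ^ 2 < _ at h3
  set S := ∑ j, (f (z j) - popMean P f)
  set Q := ∑ j, (f (z j) - popMean P f) ^ 2
  refine ⟨?_, ?_⟩
  · rw [div_le_iff₀ hn']
    refine h2.trans_eq ?_
    field_simp
  · refine h3.imp (fun h => ?_) fun h => ?_
    · rw [div_pow, div_lt_iff₀ (by positivity)]
      refine h.trans_eq ?_
      field_simp
    · rw [div_pow, div_lt_iff₀ (by positivity)]
      refine h.trans_eq ?_
      field_simp

/-- The constant in the deviation bounds relative to the population standard deviation. -/
noncomputable def devConst (Y A V : ℝ) : ℝ :=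
  √(544 * rateConst V * sampleVarConst Y A V + 64 * rateConst V * (varConst Y V + 1) +
    2 * sampleVarConst Y A V)

/-- Replaces sample by population standard deviations, as the minorant condition needs. The constant
may depend on `A`, because it is used only for the rejection of parameters outside the identified
set. -/
theorem GoodSample.abs_sub_le (hV : 0 < V) (hn : 2 ≤ n) (hf : MemLp f 2 P)
    (h : GoodSample P Y A V z (fun x => f x - ∫ y, f y ∂P)) :
    |sampleMean z f - popMean P f| ≤
        devConst Y A V * (logRate n * max (popSd P f) (logRate n)) ∧
      sampleSd z f ≤ devConst Y A V * max (popSd P f) (logRate n) := by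
  have hρ := le_rateConst hV
  obtain ⟨h1, h2⟩ := h.bounds hn hf
  have hl := logRate_pos hn
  set s := sampleMean z f - popMean P f
  set l := logRate n
  set σ := popSd P f
  have hσ : 0 ≤ σ := Real.sqrt_nonneg _
  set M := max σ l with hM
  have hMσ : σ ≤ M := le_max_left _ _
  have hMl : l ≤ M := le_max_right _ _
  have hM0 : 0 < M := hl.trans_le hMl
  have hCs : 0 ≤ sampleVarConst Y A V := by unfold sampleVarConst; positivity
  have hCv : 0 ≤ varConst Y V := by unfold varConst; positivity
  set Cs := sampleVarConst Y A V
  set ρ := rateConst V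
  have hσM : σ ^ 2 ≤ M ^ 2 := pow_le_pow_left₀ hσ hMσ 2
  have hlM : l ^ 2 ≤ M ^ 2 := pow_le_pow_left₀ hl.le hMl 2
  have hq : sampleSd z f ^ 2 + s ^ 2 ≤ 2 * Cs * M ^ 2 := by
    refine h1.trans ?_
    nlinarith
  have hd2 : devConst Y A V ^ 2 = 544 * ρ * Cs + 64 * ρ * (varConst Y V + 1) + 2 * Cs :=
    Real.sq_sqrt (by positivity)
  have hd0 : 0 ≤ devConst Y A V := Real.sqrt_nonneg _
  constructor
  · refine abs_le_of_sq_le_sq ?_ (by positivity)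
    rw [mul_pow, mul_pow, hd2]
    have a1 : 0 ≤ 544 * ρ * Cs * (l ^ 2 * M ^ 2) := by positivity
    have a2 : 0 ≤ 64 * ρ * (varConst Y V + 1) * (l ^ 2 * M ^ 2) := by positivity
    have a3 : 0 ≤ 2 * Cs * (l ^ 2 * M ^ 2) := by positivity
    rcases h2 with h2 | h2
    · have := mul_le_mul_of_nonneg_left hq (by positivity : 0 ≤ 272 * ρ * l ^ 2)
      nlinarith
    · have : 64 * ρ * (varConst Y V + 1) * (l ^ 2) ^ 2 ≤
          64 * ρ * (varConst Y V + 1) * (l ^ 2 * M ^ 2) := by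
        rw [sq (l ^ 2)]
        gcongr
      nlinarith
  · refine le_trans (le_abs_self _) (abs_le_of_sq_le_sq ?_ (by positivity))
    rw [mul_pow, hd2]
    have a1 : 0 ≤ 544 * ρ * Cs * M ^ 2 := by positivity
    have a2 : 0 ≤ 64 * ρ * (varConst Y V + 1) * M ^ 2 := by positivity
    nlinarith [sq_nonneg s]

/-- On a good sample the studentized deviation of the mean is bounded by a multiple of the rate
that depends only on `V` and `Y`. -/
theorem GoodSample.not_large_deviation (hV : 0 < V) (hn : 2 ≤ n) (hf : MemLp f 2 P)
    (h : GoodSample P Y A V z (fun x => f x - ∫ y, f y ∂P))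
    (hl : 544 * rateConst V * logRate n ^ 2 ≤ 1) {κ τ : ℝ} (hκ : 544 * rateConst V ≤ κ ^ 2)
    (hτ : 64 * rateConst V * (varConst Y V + 1) ≤ τ ^ 2) :
    (sampleMean z f - popMean P f) ^ 2 < (κ * (logRate n * sampleSd z f)) ^ 2 ∨
      (sampleMean z f - popMean P f) ^ 2 < (τ * logRate n ^ 2) ^ 2 := by
  have hρ := le_rateConst hV
  obtain ⟨-, h2⟩ := h.bounds hn hf
  refine h2.imp (fun h => ?_) fun h => ?_
  -- For `l` this small, the `dev²` on the right of the bound has coefficient at most `1 / 2` and is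
  -- absorbed, which doubles 272 to 544.
  · have h3 := mul_le_mul_of_nonneg_right hl (sq_nonneg (sampleMean z f - popMean P f))
    have h4 := mul_le_mul_of_nonneg_right hκ (by positivity :
      0 ≤ (logRate n * sampleSd z f) ^ 2)
    rw [mul_pow κ]
    nlinarith
  · rw [mul_pow τ]
    exact h.trans_le (mul_le_mul_of_nonneg_right hτ (by positivity))

end GoodSample

/-! ### The confidence region in the moment inequality model -/

section Model

variable {dX dW d dY : ℕ} {Θ : Set (Vec d)} {m : Vec dW → Vec d → Fin dY → ℝ}
  {𝒢 : Set (Vec dX → Fin dY → ℝ)}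

theorem Permissible.measurable (hG : Permissible 𝒢) {g : Vec dX → Fin dY → ℝ} (hg : g ∈ 𝒢) :
    Measurable g := by
  obtain ⟨T, _, _, e, he, rfl⟩ := hG
  obtain ⟨t, rfl⟩ := hg
  exact he.comp measurable_prodMk_left

theorem measurable_moment (hm : Measurable fun p : Vec dW × Θ => m p.1 (p.2 : Vec d))
    (hG : Permissible 𝒢) {θ : Vec d} (hθ : θ ∈ Θ) {g : Vec dX → Fin dY → ℝ} (hg : g ∈ 𝒢)
    (j : Fin dY) : Measurable (moment m θ g j) := by
  have h1 : Measurable fun z : Obs dX dW => m z.2 θ :=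
    hm.comp (measurable_snd.prodMk (measurable_const (a := (⟨θ, hθ⟩ : Θ))))
  have h2 : Measurable fun z : Obs dX dW => g z.1 := (hG.measurable hg).comp measurable_fst
  exact ((measurable_pi_apply j).comp h1).mul ((measurable_pi_apply j).comp h2)

/-- A nonempty analytic `Θ` is a continuous image of the Baire space, so the pairs `(θ, g)` are
parametrized measurably by a standard Borel space, as the projection theorem demands. -/
theorem exists_measurable_moment_family (hne : Θ.Nonempty) (hΘ : AnalyticSet Θ)
    (hm : Measurable fun p : Vec dW × Θ => m p.1 (p.2 : Vec d)) (hG : Permissible 𝒢) :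
    ∃ (I : Type) (_ : MeasurableSpace I) (_ : StandardBorelSpace I) (θ : I → Vec d)
      (g : I → Vec dX → Fin dY → ℝ), (∀ i, θ i ∈ Θ ∧ g i ∈ 𝒢) ∧
      (∀ t ∈ Θ, ∀ k ∈ 𝒢, ∃ i, θ i = t ∧ g i = k) ∧
      ∀ j, Measurable fun p : I × Obs dX dW => moment m (θ p.1) (g p.1) j p.2 := by
  obtain ⟨T, _, _, e, he, rfl⟩ := hG
  rw [AnalyticSet] at hΘ
  rcases hΘ with rfl | ⟨φ, hφ, rfl⟩
  · exact (Set.not_nonempty_empty hne).elim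
  refine ⟨(ℕ → ℕ) × T, inferInstance, inferInstance, fun i => φ i.1, fun i => e i.2,
    fun i => ⟨Set.mem_range_self _, Set.mem_range_self _⟩, ?_, fun j => ?_⟩
  · rintro _ ⟨x, rfl⟩ _ ⟨t, rfl⟩
    exact ⟨(x, t), rfl, rfl⟩
  · have hφ' : Measurable fun x : ℕ → ℕ => (⟨φ x, Set.mem_range_self x⟩ : Set.range φ) :=
      hφ.measurable.subtype_mk
    have h1 : Measurable fun p : ((ℕ → ℕ) × T) × Obs dX dW => m p.2.2 (φ p.1.1) :=
      hm.comp ((measurable_snd.comp measurable_snd).prodMk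
        (hφ'.comp (measurable_fst.comp measurable_fst)))
    have h2 : Measurable fun p : ((ℕ → ℕ) × T) × Obs dX dW => e p.1.2 p.2.1 :=
      he.comp ((measurable_snd.comp measurable_fst).prodMk (measurable_fst.comp measurable_snd))
    exact ((measurable_pi_apply j).comp h1).mul ((measurable_pi_apply j).comp h2)

theorem uniformlyLikely_goodSample {𝔓 : Set (ProbabilityMeasure (Obs dX dW))}
    {D : Set (Obs dX dW)} (hD : MeasurableSet D)
    (hPD : ∀ P ∈ 𝔓, (P : Measure (Obs dX dW)) Dᶜ = 0) (hΘ : AnalyticSet Θ)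
    (hm : Measurable fun p : Vec dW × Θ => m p.1 (p.2 : Vec d)) (hG : Permissible 𝒢)
    {Ybar A V : ℝ} (hA : 0 < A) (hV : 0 < V) (hcov : PolynomialCovering D Θ m 𝒢 Ybar A V)
    (hbd : BoundedMoments 𝔓 Θ m 𝒢 Ybar) :
    UniformlyLikely 𝔓 fun P _ z => ∀ j, ∀ θ ∈ Θ, ∀ g ∈ 𝒢,
      GoodSample (P : Measure (Obs dX dW)) (max Ybar 1) A V z
        (fun x => moment m θ g j x - ∫ y, moment m θ g j y ∂(P : Measure (Obs dX dW))) := by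
  rcases Set.eq_empty_or_nonempty Θ with rfl | hne
  · refine UniformlyLikely.of_measure_le (b := fun _ => 0) tendsto_const_nhds
      (Eventually.of_forall fun _ P _ => ?_)
    simp
  obtain ⟨I, _, _, θ, g, hI, hsurj, hmeas⟩ := exists_measurable_moment_family hne hΘ hm hG
  refine UniformlyLikely.of_measure_le
    (b := fun n : ℕ => (dY : ℝ≥0∞) * ENNReal.ofReal (12 * A / n)) ?_ ?_
  · have h1 : Tendsto (fun n : ℕ => ENNReal.ofReal (12 * A / n)) atTop (𝓝 0) := by
      have := ENNReal.tendsto_ofReal (tendsto_const_div_atTop_nhds_zero_nat (12 * A))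
      rwa [ENNReal.ofReal_zero] at this
    simpa using ENNReal.Tendsto.const_mul h1 (Or.inr (ENNReal.natCast_ne_top dY))
  · have hall : ∀ j : Fin dY, _ := fun j =>
      eventually_measure_not_goodSample_le (I := I) hD (F := momentClass Θ m 𝒢 Ybar j)
        (Y := max Ybar 1) (A := A) (V := V) (le_max_right _ _) hA.le hV
        (fun Q hQ hQD ε h0 h1 => (hcov j Q hQ hQD ε h0 h1).1) (hmeas j)
        (fun i s hs t ht => ⟨θ i, (hI i).1, g i, (hI i).2, s, hs, t, ht, rfl⟩)
    filter_upwards [eventually_all.2 hall] with n hn P hP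
    have hsub : {z : Fin n → Obs dX dW | ¬ ∀ j, ∀ θ ∈ Θ, ∀ g ∈ 𝒢,
        GoodSample (P : Measure (Obs dX dW)) (max Ybar 1) A V z (fun x => moment m θ g j x -
          ∫ y, moment m θ g j y ∂(P : Measure (Obs dX dW)))} ⊆
        ⋃ j, {z | ∃ i, ¬ GoodSample (P : Measure (Obs dX dW)) (max Ybar 1) A V z
          (fun x => moment m (θ i) (g i) j x -
            ∫ y, moment m (θ i) (g i) j y ∂(P : Measure (Obs dX dW)))} := by
      intro z (hz : ¬ _)
      push Not at hz
      obtain ⟨j, t, ht, k, hk, hbad⟩ := hz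
      obtain ⟨i, rfl, rfl⟩ := hsurj t ht k hk
      exact Set.mem_iUnion.2 ⟨j, i, hbad⟩
    refine (measure_mono hsub).trans ((measure_iUnion_fintype_le _ _).trans
      ((Finset.sum_le_sum fun j _ => hn j P inferInstance (hPD P hP) fun i => ?_).trans_eq ?_))
    · filter_upwards [hbd P hP (θ i) (hI i).1 (g i) (hI i).2 j] with z hz
      exact hz.trans (le_max_left _ _)
    · simp

/-- The unconditional moments are nonnegative on the identified set. -/
theorem popMean_nonneg_of_mem_identifiedSet {P : Measure (Obs dX dW)} [IsProbabilityMeasure P]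
    (hG : Permissible 𝒢) {θ : Vec d} {g : Vec dX → Fin dY → ℝ} (hg : g ∈ 𝒢) {j : Fin dY}
    (hint : Integrable (fun z => m z.2 θ j) P) (hmint : Integrable (moment m θ g j) P)
    (hg0 : ∀ᵐ z ∂P, 0 ≤ g z.1 j) (hθ : θ ∈ identifiedSet Θ m P) :
    0 ≤ popMean P (moment m θ g j) := by
  have hle : MeasurableSpace.comap (Prod.fst : Obs dX dW → Vec dX) inferInstance ≤
      (inferInstance : MeasurableSpace (Obs dX dW)) := measurable_fst.comap_le
  have hgm : StronglyMeasurable[MeasurableSpace.comap (Prod.fst : Obs dX dW → Vec dX)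
      inferInstance] fun z : Obs dX dW => g z.1 j :=
    (((measurable_pi_apply j).comp (hG.measurable hg)).comp
      (comap_measurable Prod.fst)).stronglyMeasurable
  have h1 := condExp_mul_of_stronglyMeasurable_right hgm hmint hint
  rw [popMean, ← integral_condExp hle]
  refine integral_nonneg_of_ae ?_
  filter_upwards [h1, hθ.2 j, hg0] with z e1 e2 e3
  refine le_of_le_of_eq ?_ e1.symm
  exact mul_nonneg e2 e3

/-- For `n ≥ 2` the normalizing factor is `1 / logRate n`, positive and finite, and can be moved
across. Nonnegativity of `c` covers an empty `𝒢`. -/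
theorem mem_region_iff {S : (Fin dY → ℝ) → ℝ≥0} {n : ℕ} (hn : 2 ≤ n) {z : Fin n → Obs dX dW}
    {σ c : ℝ} (hc : 0 ≤ c) {θ : Vec d} :
    θ ∈ region Θ m 𝒢 S z σ c ↔ θ ∈ Θ ∧ ∀ g ∈ 𝒢,
      (S (fun j => sampleMean z (moment m θ g j) / max (sampleSd z (moment m θ g j)) σ) : ℝ) ≤
        c * logRate n := by
  have hl := logRate_pos hn
  have hs : √(n : ℝ) / √(Real.log n) = (logRate n)⁻¹ := by
    rw [← sqrt_div_log, Real.sqrt_div (Nat.cast_nonneg _)]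
  have hl' : (0 : EReal) ≤ (((logRate n)⁻¹ : ℝ) : EReal) := by
    exact_mod_cast (inv_pos.2 hl).le
  unfold region
  rw [Set.mem_ofPred_eq, hs]
  refine and_congr_right fun _ => ⟨fun h g hg => ?_, fun h => ?_⟩
  · have h1 : ((S (fun j => sampleMean z (moment m θ g j) /
        max (sampleSd z (moment m θ g j)) σ) : ℝ≥0∞) : EReal) ≤ (ksStat m 𝒢 S z σ θ : EReal) :=
      EReal.coe_ennreal_le_coe_ennreal_iff.2 (le_iSup₂ (f := fun g (_ : g ∈ 𝒢) =>
        (S (fun j => sampleMean z (moment m θ g j) /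
          max (sampleSd z (moment m θ g j)) σ) : ℝ≥0∞)) g hg)
    have h2 := (mul_le_mul_of_nonneg_left h1 hl').trans h
    rw [EReal.coe_nnreal_eq_coe_real, ← EReal.coe_mul, EReal.coe_le_coe_iff,
      inv_mul_le_iff₀ hl] at h2
    linarith
  · have h1 : ksStat m 𝒢 S z σ θ ≤ ENNReal.ofReal (c * logRate n) := by
      refine iSup₂_le fun g hg => ?_
      rw [← ENNReal.ofReal_coe_nnreal]
      exact ENNReal.ofReal_le_ofReal (h g hg)
    have h2 : (ksStat m 𝒢 S z σ θ : EReal) ≤ ((c * logRate n : ℝ) : EReal) := by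
      refine (EReal.coe_ennreal_le_coe_ennreal_iff.2 h1).trans_eq ?_
      rw [EReal.coe_ennreal_ofReal, max_eq_left (by positivity)]
    refine (mul_le_mul_of_nonneg_left h2 hl').trans_eq ?_
    rw [← EReal.coe_mul]
    congr 1
    field_simp

end Model

theorem inv_sq_rpow_half {x : ℝ} (hx : 0 < x) (t : ℝ) : ((x ^ 2)⁻¹) ^ (t / 2) = (x ^ t)⁻¹ := by
  rw [Real.inv_rpow (by positivity), ← Real.rpow_natCast, ← Real.rpow_mul hx.le]
  congr 2
  push_cast
  ring

/-- The threshold for the constant `K`. -/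
noncomputable def cutoffConst (V Ybar K₁ : ℝ) : ℝ :=
  max 1 (√(544 * rateConst V + 64 * rateConst V * (varConst (max Ybar 1) V + 1)) / K₁)

/-- The studentized mean is below `-x K₂` close to the identified set. -/
theorem studentized_lt_of_minorant {C Cd M K₂ B l x q ψ μ mean σp σs σn : ℝ} (hC : 0 < C)
    (hCd : 0 ≤ Cd) (hM : 0 ≤ M) (hK₂ : 0 < K₂) (hB1 : 1 ≤ B) (hB2 : 4 * Cd / C ≤ B)
    (hB3 : 4 * ((Cd + M) * K₂) / C ≤ B) (hl : 0 < l) (hl1 : l ≤ 1) (hlx : l ≤ x)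
    (hq : B * x < q) (hψ : 0 < ψ) (hψ1 : ψ ≤ 1)
    (hdev : |mean - μ| ≤ Cd * (l * max σp l)) (hσs : σs ≤ Cd * max σp l) (hσn0 : 0 < σn)
    (hσn : σn ≤ M * l ^ ψ) (hμ : μ < -(C / 2 * q) * max σp (q ^ ψ)) :
    mean / max σs σn < -(x * K₂) := by
  have hx : 0 < x := hl.trans_le hlx
  have hxq : x < q := lt_of_le_of_lt (le_mul_of_one_le_left hx.le hB1) hq
  have hlq : l ≤ q := hlx.trans hxq.le
  have hq0 : 0 < q := hx.trans hxq
  have hpow : l ^ ψ ≤ q ^ ψ := Real.rpow_le_rpow hl.le hlq hψ.le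
  have hlpow : l ≤ l ^ ψ := by
    have := Real.rpow_le_rpow_of_exponent_ge hl hl1 hψ1
    rwa [Real.rpow_one] at this
  set W := max σp (q ^ ψ) with hW
  have hWq : q ^ ψ ≤ W := le_max_right _ _
  have hW0 : 0 < W := (Real.rpow_pos_of_pos hq0 ψ).trans_le hWq
  have hWl : max σp l ≤ W := max_le_max le_rfl (hlpow.trans hpow)
  -- Both parts of the denominator are of order `W`. The drift `-(C / 2) q W` then pays for the
  -- deviation and for `x K₂` times the denominator, each at most `(C / 4) q W`.
  have hden : max σs σn ≤ (Cd + M) * W := by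
    refine max_le ?_ ?_
    · have := mul_le_mul_of_nonneg_left hWl hCd
      nlinarith
    · have := mul_le_mul_of_nonneg_left (hpow.trans hWq) hM
      nlinarith
  have hden0 : 0 < max σs σn := hσn0.trans_le (le_max_right _ _)
  rw [div_lt_iff₀ hden0]
  have h1 : mean ≤ μ + Cd * (l * W) := by
    have h2 : Cd * (l * max σp l) ≤ Cd * (l * W) := by gcongr
    linarith [(abs_le.1 hdev).2]
  have h3 : Cd * l ≤ C / 4 * q := by
    rw [div_le_iff₀ hC] at hB2
    have h4 : B * l ≤ q := (mul_le_mul_of_nonneg_left hlx (by linarith)).trans hq.le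
    nlinarith
  have h5 : (Cd + M) * K₂ * x ≤ C / 4 * q := by
    rw [div_le_iff₀ hC] at hB3
    nlinarith
  have h6 : x * K₂ * max σs σn ≤ C / 4 * q * W := by
    refine (mul_le_mul_of_nonneg_left hden (by positivity)).trans ?_
    have := mul_le_mul_of_nonneg_right h5 hW0.le
    linarith
  have h7 := mul_le_mul_of_nonneg_right h3 hW0.le
  linarith

/-- The studentized mean is below `-x K₂` far from the identified set. -/
theorem studentized_lt_of_mean_lt {Cd M Y K₂ δ l x μ mean σp σs σn : ℝ} (hCd : 0 ≤ Cd)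
    (hM : 0 ≤ M) (hY : 1 ≤ Y) (hK₂ : 0 < K₂) (hδ : 0 < δ) (hl : 0 < l) (hl1 : l ≤ 1)
    (hlδ : (Cd * Y) * l ≤ δ / 2) (hx : 0 < x) (hxδ : x ≤ δ / (4 * ((Cd * Y + M + 1) * K₂)))
    (hdev : |mean - μ| ≤ Cd * (l * max σp l)) (hσs : σs ≤ Cd * max σp l) (hσp : σp ≤ Y)
    (hσn0 : 0 < σn) (hσn : σn ≤ M) (hμ : μ < -δ) :
    mean / max σs σn < -(x * K₂) := by
  have hW : max σp l ≤ Y := max_le hσp (hl1.trans hY)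
  have hden0 : 0 < max σs σn := hσn0.trans_le (le_max_right _ _)
  have hCY : 0 ≤ Cd * Y := by positivity
  have hden : max σs σn ≤ Cd * Y + M + 1 :=
    max_le (hσs.trans ((mul_le_mul_of_nonneg_left hW hCd).trans (by linarith))) (by linarith)
  have h1 : Cd * (l * max σp l) ≤ Cd * Y * l := by
    rw [mul_comm l, ← mul_assoc]
    gcongr
  rw [div_lt_iff₀ hden0]
  rw [le_div_iff₀ (by positivity)] at hxδ
  have h2 : x * K₂ * max σs σn ≤ x * K₂ * (Cd * Y + M + 1) := by gcongr
  linarith [(abs_le.1 hdev).2]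

/-! ### Coverage of the identified set and rejection outside it. -/

section Main

variable {dX dW d dY : ℕ} {Θ : Set (Vec d)} {m : Vec dW → Vec d → Fin dY → ℝ}
  {𝒢 : Set (Vec dX → Fin dY → ℝ)} {S : (Fin dY → ℝ) → ℝ≥0} {P : Measure (Obs dX dW)}
  [IsProbabilityMeasure P] {n : ℕ} {z : Fin n → Obs dX dW} {V Ybar K₁ K₂ A K c σ : ℝ}
  {θ : Vec d}

/-- If the statistic exceeded its bound, some studentized mean would be at most `-c l K₁`. As the
population mean is nonnegative, the deviation would be at least `K K₁ l (σ̂ ∨ σ)`. Bounding the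
maximum below by `σ̂` contradicts one alternative of `GoodSample.not_large_deviation`, and by `σ ≥ K
l` the other. -/
theorem mem_region_of_mem_identifiedSet (hV : 0 < V) (hK₁ : 0 < K₁)
    (hS : ScaleFunction S K₁ K₂) (hn : 2 ≤ n)
    (hl : 544 * rateConst V * logRate n ^ 2 ≤ 1) (hK : cutoffConst V Ybar K₁ < K) (hc : K ≤ c)
    (hσ : K * logRate n ≤ σ) (hLp : ∀ g ∈ 𝒢, ∀ j, MemLp (moment m θ g j) 2 P)
    (hmean : ∀ g ∈ 𝒢, ∀ j, 0 ≤ popMean P (moment m θ g j))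
    (hgood : ∀ j, ∀ g ∈ 𝒢, GoodSample P (max Ybar 1) A V z
      (fun x => moment m θ g j x - ∫ y, moment m θ g j y ∂P))
    (hθ : θ ∈ Θ) : θ ∈ region Θ m 𝒢 S z σ c := by
  have hρ := le_rateConst hV
  have hl0 := logRate_pos hn
  have hK1 : 1 < K := (le_max_left _ _).trans_lt hK
  have hR0 : 0 ≤ rateConst V := by linarith
  have hCv : 0 ≤ varConst (max Ybar 1) V := by unfold varConst; positivity
  have hKK : √(544 * rateConst V + 64 * rateConst V * (varConst (max Ybar 1) V + 1)) ≤ K * K₁ :=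
    (div_le_iff₀ hK₁).1 ((le_max_right _ _).trans hK.le)
  have hKK2 := (Real.sqrt_le_left (by positivity)).1 hKK
  -- The alternative of order `l²` has the constant `K · K K₁`; since `K > 1`, the lower bound on `K
  -- K₁` suffices for it too.
  have hτ1 : (K * K₁) ^ 2 ≤ (K * (K * K₁)) ^ 2 :=
    pow_le_pow_left₀ (by positivity) (le_mul_of_one_le_left (by positivity) hK1.le) 2
  have hr1 : 0 ≤ 544 * rateConst V := by positivity
  have hr2 : 0 ≤ 64 * rateConst V * (varConst (max Ybar 1) V + 1) := by positivity
  refine (mem_region_iff hn (by linarith)).2 ⟨hθ, fun g hg => ?_⟩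
  by_contra hlt
  rw [not_le] at hlt
  have hcl : 0 < c * logRate n := mul_pos (by linarith) hl0
  obtain ⟨j, hj⟩ := (hS.2 _ hcl _).1 hlt.le
  have hσ0 : 0 < σ := lt_of_lt_of_le (mul_pos (by linarith) hl0) hσ
  have hden0 : 0 < max (sampleSd z (moment m θ g j)) σ := hσ0.trans_le (le_max_right _ _)
  rw [div_le_iff₀ hden0] at hj
  have hμ := hmean g hg j
  set s := sampleMean z (moment m θ g j)
  set μ := popMean P (moment m θ g j)
  set ss := sampleSd z (moment m θ g j)
  have hss : 0 ≤ ss := Real.sqrt_nonneg _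
  have hdev : K * K₁ * logRate n * max ss σ ≤ μ - s := by
    have h1 : K * K₁ * logRate n * max ss σ ≤ c * logRate n * K₁ * max ss σ := by
      refine mul_le_mul_of_nonneg_right ?_ hden0.le
      rw [mul_right_comm]
      gcongr
    linarith
  rcases (hgood j g hg).not_large_deviation hV hn (hLp g hg j) hl (κ := K * K₁)
    (τ := K * (K * K₁)) (by linarith) (by linarith) with h | h
  · refine absurd h (not_lt.2 ?_)
    rw [← neg_sq (s - μ), neg_sub]
    refine pow_le_pow_left₀ (by positivity) (le_trans ?_ hdev) 2
    rw [← mul_assoc]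
    gcongr
    exact le_max_left _ _
  · refine absurd h (not_lt.2 ?_)
    rw [← neg_sq (s - μ), neg_sub]
    refine pow_le_pow_left₀ (by positivity) (le_trans ?_ hdev) 2
    calc K * (K * K₁) * logRate n ^ 2 = K * K₁ * logRate n * (K * logRate n) := by ring
      _ ≤ K * K₁ * logRate n * max ss σ := by
          gcongr
          exact hσ.trans (le_max_right _ _)

theorem not_mem_region_of_studentized_lt (hS : ScaleFunction S K₁ K₂) (hn : 2 ≤ n) (hc : 0 < c)
    {g : Vec dX → Fin dY → ℝ} (hg : g ∈ 𝒢) {j : Fin dY}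
    (h : sampleMean z (moment m θ g j) / max (sampleSd z (moment m θ g j)) σ <
      -(c * logRate n * K₂)) : θ ∉ region Θ m 𝒢 S z σ c := by
  intro hmem
  have h1 := ((mem_region_iff hn hc.le).1 hmem).2 g hg
  have h2 := (hS.2 _ (mul_pos hc (logRate_pos hn)) _).2 h1 j
  exact absurd h (not_lt.2 h2)

theorem popSd_le {Z : Type*} [MeasurableSpace Z] {P : Measure Z} [IsProbabilityMeasure P]
    {f : Z → ℝ} {Y : ℝ} (hY : 0 ≤ Y) (hf : MemLp f 2 P) (h : ∀ᵐ z ∂P, |f z| ≤ Y) :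
    popSd P f ≤ Y := by
  refine Real.sqrt_le_iff.2 ⟨hY, ?_⟩
  have h1 : ∫ z, f z ^ 2 ∂P ≤ ∫ _z, Y ^ 2 ∂P := by
    refine integral_mono_ae hf.integrable_sq (integrable_const _) ?_
    filter_upwards [h] with z hz
    exact sq_le_sq.2 (hz.trans (le_abs_self Y))
  rw [integral_const] at h1
  simp only [probReal_univ, one_smul] at h1
  nlinarith [sq_nonneg (∫ z, f z ∂P)]

/-- The infimum need not be attained; halving `C` leaves room for an actual pair `(g, j)`. -/
theorem PolynomialMinorant.exists_lt {𝔓 : Set (ProbabilityMeasure (Obs dX dW))} {C ψ γ δ : ℝ}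
    (h : PolynomialMinorant 𝔓 Θ m 𝒢 C ψ γ δ) (hC : 0 < C) {P : ProbabilityMeasure (Obs dX dW)}
    (hP : P ∈ 𝔓) (hθ : θ ∈ Θ) {r : ℝ} (hr : 0 < r) (hrδ : r ≤ δ)
    (hd : Metric.infEDist θ (identifiedSet Θ m (P : Measure (Obs dX dW))) = ENNReal.ofReal r) :
    ∃ g ∈ 𝒢, ∃ j, popMean (P : Measure (Obs dX dW)) (moment m θ g j) <
      -(C / 2 * r ^ (1 / γ)) * max (popSd (P : Measure (Obs dX dW)) (moment m θ g j))
        ((r ^ (1 / γ)) ^ ψ) := by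
  have hq : 0 < r ^ (1 / γ) := Real.rpow_pos_of_pos hr _
  have h1 : ((-(C * r ^ (1 / γ)) : ℝ) : EReal) < ((-(C / 2 * r ^ (1 / γ)) : ℝ) : EReal) := by
    rw [EReal.coe_lt_coe_iff]
    nlinarith
  have h2 := (h P hP θ hθ r hr hrδ hd).trans_lt h1
  simp only [iInf_lt_iff] at h2
  obtain ⟨g, hg, j, hj⟩ := h2
  refine ⟨g, hg, j, ?_⟩
  rw [EReal.coe_lt_coe_iff, div_lt_iff₀ ((Real.rpow_pos_of_pos hr _).trans_le (le_max_right _ _)),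
    show ψ / γ = 1 / γ * ψ by ring, Real.rpow_mul hr.le] at hj
  exact hj

end Main

end KSRegion

theorem theorem3 :
    ∀ V Ybar K₁ : ℝ, 0 < V → 0 ≤ Ybar → 0 < K₁ →
    ∃ K₀ : ℝ,
    ∀ (dX dW d dY : ℕ)
      -- the class of distributions and the sample space
      (𝔓 : Set (ProbabilityMeasure (KSRegion.Obs dX dW)))
      (D : Set (KSRegion.Obs dX dW)) (_ : MeasurableSet D)
      (_ : ∀ P ∈ 𝔓, (P : Measure (KSRegion.Obs dX dW)) Dᶜ = 0)
      -- the parameter space, the moment function and the class of weighting functions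
      (Θ : Set (KSRegion.Vec d)) (_ : AnalyticSet Θ)
      (m : KSRegion.Vec dW → KSRegion.Vec d → Fin dY → ℝ)
      (_ : Measurable fun p : KSRegion.Vec dW × Θ => m p.1 (p.2 : KSRegion.Vec d))
      (_ : ∀ P ∈ 𝔓, ∀ θ ∈ Θ, ∀ j,
        Integrable (fun z => m z.2 θ j) (P : Measure (KSRegion.Obs dX dW)))
      (𝒢 : Set (KSRegion.Vec dX → Fin dY → ℝ)) (_ : KSRegion.Permissible 𝒢)
      (S : (Fin dY → ℝ) → ℝ≥0)
      -- the truncation points, their lower bounds and the critical values (functions of the data)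
      (σ a c : (n : ℕ) → (Fin n → KSRegion.Obs dX dW) → ℝ)
      (A K K₂ C ψ γ δ : ℝ),
      KSRegion.NonnegWeights 𝔓 𝒢 →
      0 < A → KSRegion.PolynomialCovering D Θ m 𝒢 Ybar A V →
      KSRegion.BoundedMoments 𝔓 Θ m 𝒢 Ybar →
      0 < K₂ → KSRegion.ScaleFunction S K₁ K₂ →
      -- the cutoffs are bounded above, and below by `a`
      (∃ M : ℝ, KSRegion.UniformWPA1 𝔓 fun n z => σ n z ≤ M) →
      KSRegion.UniformWPA1 𝔓 (fun n z => a n z ≤ σ n z * √((n : ℝ) / Real.log n)) →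
      -- the requirements on `a` and `c`
      K₀ < K →
      KSRegion.UniformWPA1 𝔓 (fun n z => K ≤ a n z) →
      KSRegion.UniformWPA1 𝔓 (fun n z => K ≤ c n z) →
      (∀ η : ℝ, 0 < η →
        KSRegion.UniformWPA1 𝔓 fun n z => c n z * √(Real.log n / (n : ℝ)) ≤ η) →
      KSRegion.ConsistencyCondition 𝔓 Θ m 𝒢 →
      -- the polynomial minorant condition and the rate condition on the cutoffs
      0 < C → 0 < ψ → ψ ≤ 1 → 0 < γ → 0 < δ →
      KSRegion.PolynomialMinorant 𝔓 Θ m 𝒢 C ψ γ δ →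
      (∃ M : ℝ, KSRegion.UniformWPA1 𝔓 fun n z => σ n z * ((n : ℝ) / Real.log n) ^ (ψ / 2) ≤ M) →
      ∃ B : ℝ, 0 < B ∧
        Tendsto (fun n : ℕ => ⨆ P ∈ 𝔓,
          (Measure.pi fun _ : Fin n => (P : Measure (KSRegion.Obs dX dW)))
            {z | ENNReal.ofReal B <
              ENNReal.ofReal (((n : ℝ) / (c n z ^ 2 * Real.log n)) ^ (γ / 2)) *
                Metric.hausdorffEDist (KSRegion.region Θ m 𝒢 S z (σ n z) (c n z))
                  (KSRegion.identifiedSet Θ m (P : Measure (KSRegion.Obs dX dW)))})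
          atTop (𝓝 0) := by
  open KSRegion in
  intro V Ybar K₁ hV _ hK₁
  refine ⟨cutoffConst V Ybar K₁, ?_⟩
  intro dX dW d dY 𝔓 D hD hPD Θ hΘ m hm hmint 𝒢 hG S σ a c A K K₂ C ψ γ δ hg0 hA hcov hbd hK₂ hS
    ⟨M, hσM⟩ haσ hK haK hcK hcη hcons hC hψ hψ1 hγ hδ hmin ⟨M', hσM'⟩
  obtain ⟨δ', hδ', hfar⟩ := hcons δ hδ
  set Y := max Ybar 1 with hY
  set Cd := devConst Y A V
  have hY1 : 1 ≤ Y := le_max_right _ _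
  have hCd : 0 ≤ Cd := Real.sqrt_nonneg _
  set B₁ := max 1 (max (4 * Cd / C) (4 * ((Cd + |M'|) * K₂) / C)) with hB₁
  have hB1 : 1 ≤ B₁ := le_max_left _ _
  have hB2 : 4 * Cd / C ≤ B₁ := (le_max_left _ _).trans (le_max_right _ _)
  have hB3 : 4 * ((Cd + |M'|) * K₂) / C ≤ B₁ := (le_max_right _ _).trans (le_max_right _ _)
  have hB₁0 : 0 < B₁ := zero_lt_one.trans_le hB1
  have hB : 0 < B₁ ^ γ := Real.rpow_pos_of_pos hB₁0 _
  have hK1 : 1 < K := (le_max_left _ _).trans_lt hK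
  -- Below this value of `c l`, the studentized drift `-δ'` far from the identified set still beats
  -- `c l K₂`; the denominator there is at most `Cd * Y + |M| + 1`.
  set η := δ' / (4 * ((Cd * Y + |M| + 1) * K₂))
  have hη : 0 < η := by positivity
  have hρ := le_rateConst hV
  have hρ0 : 0 < rateConst V := by linarith
  have hsmall : 0 < √(1 / (544 * rateConst V)) := Real.sqrt_pos.2 (by positivity)
  have hsmall' : 0 < δ' / 2 / (Cd * Y + 1) := by positivity
  refine ⟨B₁ ^ γ, hB, ?_⟩
  have hlik := (((((((uniformlyLikely_goodSample hD hPD hΘ hm hG hA hV hcov hbd).and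
    (.of_uniformWPA1 hσM)).and (.of_uniformWPA1 haσ)).and (.of_uniformWPA1 haK)).and
    (.of_uniformWPA1 hcK)).and (.of_uniformWPA1 (hcη η hη))).and (.of_uniformWPA1 hσM'))
  suffices h : UniformlyLikely 𝔓 fun P n z =>
      ENNReal.ofReal (((n : ℝ) / (c n z ^ 2 * Real.log n)) ^ (γ / 2)) *
        Metric.hausdorffEDist (region Θ m 𝒢 S z (σ n z) (c n z))
          (identifiedSet Θ m (P : Measure (Obs dX dW))) ≤ ENNReal.ofReal (B₁ ^ γ) by
    simpa only [UniformlyLikely, not_le] using h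
  refine hlik.mono ?_
  filter_upwards [eventually_ge_atTop 2, eventually_logRate_le zero_lt_one,
    eventually_logRate_le hsmall, eventually_logRate_le hsmall'] with n hn hl1 hl2 hl3
  rintro P hP z ⟨⟨⟨⟨⟨⟨hgood, hz1⟩, hz2⟩, hz3⟩, hz4⟩, hz5⟩, hz6⟩
  have hl := logRate_pos hn
  have hn1 : 1 ≤ n := by omega
  have hl2' : 544 * rateConst V * logRate n ^ 2 ≤ 1 := by
    have := (Real.le_sqrt hl.le (by positivity)).1 hl2
    rwa [le_div_iff₀ (by positivity), mul_comm] at this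
  have hl3' : Cd * Y * logRate n ≤ δ' / 2 := by
    rw [le_div_iff₀ (by positivity)] at hl3
    nlinarith
  set l := logRate n
  have hc0 : 0 < c n z := by linarith
  have hx0 : 0 < c n z * l := mul_pos hc0 hl
  have hlx : l ≤ c n z * l := le_mul_of_one_le_left hl.le (by linarith)
  have hσK : K * l ≤ σ n z := by
    rw [sqrt_div_log] at hz2
    exact (le_mul_inv_iff₀ hl).1 (hz3.trans hz2)
  have hσ0 : 0 < σ n z := lt_of_lt_of_le (mul_pos (by linarith) hl) hσK
  have hσψ : σ n z ≤ |M'| * l ^ ψ := by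
    have e : (n : ℝ) / Real.log n = (l ^ 2)⁻¹ := by rw [logRate_sq hn1, inv_div]
    rw [e, inv_sq_rpow_half hl] at hz6
    exact (mul_inv_le_iff₀ (Real.rpow_pos_of_pos hl _)).1 (hz6.trans (le_abs_self _))
  have hbdY : ∀ θ ∈ Θ, ∀ g ∈ 𝒢, ∀ j,
      ∀ᵐ x ∂(P : Measure (Obs dX dW)), |moment m θ g j x| ≤ Y := by
    intro θ hθ g hg j
    filter_upwards [hbd P hP θ hθ g hg j] with x hx
    exact hx.trans (le_max_left _ _)
  have hLp : ∀ θ ∈ Θ, ∀ g ∈ 𝒢, ∀ j,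
      MemLp (moment m θ g j) 2 (P : Measure (Obs dX dW)) := fun θ hθ g hg j =>
    MemLp.of_bound (measurable_moment hm hG hθ hg j).aestronglyMeasurable Y (hbdY θ hθ g hg j)
  have hfinal : Metric.hausdorffEDist (region Θ m 𝒢 S z (σ n z) (c n z))
      (identifiedSet Θ m (P : Measure (Obs dX dW))) ≤
      ENNReal.ofReal (B₁ ^ γ * (c n z * l) ^ γ) := by
    refine Metric.hausdorffEDist_le_of_infEDist (fun θ hθr => ?_) fun θ hθ0 => ?_
    · have hθ : θ ∈ Θ := hθr.1
      by_contra hlt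
      rw [not_le] at hlt
      have hdev := fun g hg j => (hgood j θ hθ g hg).abs_sub_le hV hn (hLp θ hθ g hg j)
      -- The first case includes an empty identified set, where the distance is `⊤`.
      rcases lt_or_ge (ENNReal.ofReal δ)
        (Metric.infEDist θ (identifiedSet Θ m (P : Measure (Obs dX dW)))) with hcase | hcase
      · obtain ⟨g, hg, j, hμ⟩ := hfar P hP θ hθ hcase
        refine not_mem_region_of_studentized_lt hS hn hc0 hg (j := j) ?_ hθr
        exact studentized_lt_of_mean_lt hCd (abs_nonneg M) hY1 hK₂ hδ' hl hl1 hl3' hx0 hz5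
          (hdev g hg j).1 (hdev g hg j).2
          (popSd_le (by linarith) (hLp θ hθ g hg j) (hbdY θ hθ g hg j)) hσ0
          (hz1.trans (le_abs_self _)) hμ
      · have hne : Metric.infEDist θ (identifiedSet Θ m (P : Measure (Obs dX dW))) ≠ ⊤ :=
          (hcase.trans_lt ENNReal.ofReal_lt_top).ne
        set r := (Metric.infEDist θ (identifiedSet Θ m (P : Measure (Obs dX dW)))).toReal with hr
        have hdr : Metric.infEDist θ (identifiedSet Θ m (P : Measure (Obs dX dW))) =
          ENNReal.ofReal r := (ENNReal.ofReal_toReal hne).symm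
        rw [hdr] at hlt hcase
        have hr1 : B₁ ^ γ * (c n z * l) ^ γ < r := (ENNReal.ofReal_lt_ofReal_iff'.1 hlt).1
        have hr0 : 0 < r := lt_trans (by positivity) hr1
        have hrδ : r ≤ δ := (ENNReal.ofReal_le_ofReal_iff hδ.le).1 hcase
        obtain ⟨g, hg, j, hμ⟩ := hmin.exists_lt hC hP hθ hr0 hrδ hdr
        refine not_mem_region_of_studentized_lt hS hn hc0 hg (j := j) ?_ hθr
        have hq : B₁ * (c n z * l) < r ^ (1 / γ) := by
          rw [← Real.mul_rpow hB₁0.le hx0.le] at hr1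
          have := Real.rpow_lt_rpow (by positivity) hr1 (one_div_pos.2 hγ)
          rwa [← Real.rpow_mul (by positivity), mul_one_div_cancel hγ.ne', Real.rpow_one] at this
        exact studentized_lt_of_minorant hC hCd (abs_nonneg M') hK₂ hB1 hB2 hB3 hl hl1 hlx hq hψ
          hψ1 (hdev g hg j).1 (hdev g hg j).2 hσ0 hσψ hμ
    -- The identified set is contained in the region, so this side of the Hausdorff distance
    -- vanishes.
    · have hθ : θ ∈ Θ := hθ0.1
      have hmem : θ ∈ region Θ m 𝒢 S z (σ n z) (c n z) :=
        mem_region_of_mem_identifiedSet hV hK₁ hS hn hl2' hK hz4 hσK (hLp θ hθ)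
          (fun g hg j => popMean_nonneg_of_mem_identifiedSet hG hg (hmint P hP θ hθ j)
            ((hLp θ hθ g hg j).integrable one_le_two) (hg0 P hP g hg j) hθ0)
          (fun j g hg => hgood j θ hθ g hg) hθ
      rw [Metric.infEDist_zero_of_mem hmem]
      exact zero_le
  -- The normalization is exactly `(c l)^{-γ}`, which cancels the factor `(c l)^γ` of the bound.
  have hrate : (n : ℝ) / (c n z ^ 2 * Real.log n) = ((c n z * l) ^ 2)⁻¹ := by
    rw [mul_pow, logRate_sq hn1, ← mul_div_assoc, inv_div]
  rw [hrate, inv_sq_rpow_half hx0]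
  refine (mul_le_mul_right hfinal _).trans_eq ?_
  rw [← ENNReal.ofReal_mul (by positivity)]
  congr 1
  have : (c n z * l) ^ γ ≠ 0 := (Real.rpow_pos_of_pos hx0 _).ne'
  field_simp
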